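/- Let $b_k,c_k,s_k$ ($k\in\mathbb Z/6$) be real parameters (the Bennett ratios, angle cosines and offsets of a closed 6R linkage), and put $f_k=b_kc_k$. For $k=1,\dots,6$ let \[ Q_k^+(x)=\Bigl(x+\tfrac{f_k-f_{k+2}-f_{k+3}+f_{k+5}}{4}+\mathrm i\,\tfrac{s_{k+3}-s_k}{4}\Bigr)^2+\tfrac{c_{k+1}}2(b_kb_{k+2}-s_{k+1}s_{k+2})-\tfrac14\bigl(b_k^2+b_{k+2}^2-b_{k+1}^2+f_{k+1}^2-s_{k+1}^2-s_{k+2}^2\bigr) \] \[ \qquad+\tfrac{\mathrm i}2\bigl(s_{k+1}(b_k-b_{k+2}c_{k+1})+s_{k+2}(b_{k+2}-b_kc_{k+1})\bigr)\in\mathbb C[x], \] and let $Q_k^-$ be obtained from $Q_k^+$ by substituting $-b_j,\ -c_j,\ (-1)^js_j$ for $b_j,c_j,s_j$ ($j=1,\dots,6$). The six equalities $Q_k^\pm=Q_{k+3}^\pm$ ($k=1,2,3$) are equivalent to 24 real equations, namely the equalities of the real and imaginary parts of the linear and constant coefficients. (a) The zero set of these 24 equations in $\mathbb R^{18}$ is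 the union of the two sets $V_1,V_2$ on which $s_1=\dots=s_6=0$, \[ b_1c_2b_3=b_4c_5b_6,\qquad b_2c_3b_4=b_5c_6b_1,\qquad b_3c_4b_5=b_6c_1b_2,\tag{$*$} \] and, respectively, (1) $f_1=f_4,\ f_2=f_5,\ f_3=f_6,\ b_1b_3b_5=b_2b_4b_6,\ b_1^2+b_3^2+b_5^2=b_2^2+b_4^2+b_6^2$; (2) $f_1=f_3=f_5,\ f_2=f_4=f_6,\ b_1b_3b_5f_2=b_2b_4b_6f_1,\ b_1^2+b_3^2+b_5^2+f_2^2=b_2^2+b_4^2+b_6^2+f_1^2$. (b) Assume that no two adjacent axes are parallel ($-1<c_k<1$ for all $k$) and that all coupling dimensions $l_{k,k+1,k+2}$ are $8$ (for no $k$ are both $s_{k+1}=0$ and $b_k^2=b_{k+1}^2$). Then the zero set, as a subset of the points of $\mathbb R^{18}$ satisfying these assumptions, with its Zariski topology, has exactly two distinct irreducible components, namely its intersections with $V_1$ and with $V_2$. (c) If no $b_k$ is zero, then the equations $(*)$ follow from (1), and also from (2). -/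

import Mathlib

/-- The invariant parameters of a closed 6R linkage: Bennett ratios `b k`, angle cosines `c k` and
offsets `s k`, indexed cyclically modulo 6 (so the index `6` is the index `0`). -/
@[ext]
structure DHParam where
  b : ZMod 6 → ℝ
  c : ZMod 6 → ℝ
  s : ZMod 6 → ℝ

namespace DHParam

/-- The 18 coordinates of a parameter point. -/
def coords (p : DHParam) : ZMod 6 ⊕ ZMod 6 ⊕ ZMod 6 → ℝ :=
  Sum.elim p.b (Sum.elim p.c p.s)

/-- The common real zeros of a set of polynomials in the 18 parameters. -/
def zeros (S : Set (MvPolynomial (ZMod 6 ⊕ ZMod 6 ⊕ ZMod 6) ℝ)) : Set DHParam :=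
  {p | ∀ P ∈ S, MvPolynomial.eval p.coords P = 0}

theorem zeros_union_eq (S T : Set (MvPolynomial (ZMod 6 ⊕ ZMod 6 ⊕ ZMod 6) ℝ)) :
    zeros S ∪ zeros T = zeros {R | ∃ P ∈ S, ∃ Q ∈ T, R = P * Q} := by
  ext p
  constructor
  · rintro (h | h) R ⟨P, hP, Q, hQ, rfl⟩
    · rw [map_mul, h P hP, zero_mul]
    · rw [map_mul, h Q hQ, mul_zero]
  · intro h
    by_contra hn
    simp only [Set.mem_union, not_or, zeros, Set.mem_ofPred_eq, not_forall] at hn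
    obtain ⟨⟨P, hP, hP0⟩, Q, hQ, hQ0⟩ := hn
    have h' := h (P * Q) ⟨P, hP, Q, hQ, rfl⟩
    rw [map_mul] at h'
    exact (mul_ne_zero hP0 hQ0) h'

/-- The Zariski topology on the parameter space `ℝ¹⁸`: the closed sets are exactly the common zero
sets of real polynomials in the 18 parameters. -/
instance zariski : TopologicalSpace DHParam :=
  TopologicalSpace.ofClosed {Z | ∃ S, Z = zeros S}
    ⟨{1}, by ext p; simp [zeros]⟩
    (by
      intro A hA
      have hA' : ∀ Z, ∃ S, Z ∈ A → Z = zeros S := fun Z => by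
        by_cases hZ : Z ∈ A
        · obtain ⟨S, hS⟩ := hA hZ
          exact ⟨S, fun _ => hS⟩
        · exact ⟨∅, fun h => absurd h hZ⟩
      choose S hS using hA'
      refine ⟨⋃ Z ∈ A, S Z, ?_⟩
      ext p
      simp only [Set.mem_sInter, zeros, Set.mem_ofPred_eq, Set.mem_iUnion, exists_prop]
      constructor
      · rintro h P ⟨Z, hZ, hP⟩
        have hp := h Z hZ
        rw [hS Z hZ] at hp
        exact hp P hP
      · intro h Z hZ
        rw [hS Z hZ]
        exact fun P hP => h P ⟨Z, hZ, hP⟩)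
    (by
      rintro _ ⟨S, rfl⟩ _ ⟨T, rfl⟩
      exact ⟨_, zeros_union_eq S T⟩)

theorem isClosed_iff_zeros (Z : Set DHParam) : IsClosed Z ↔ ∃ S, Z = zeros S := by
  rw [← isOpen_compl_iff]
  change Zᶜᶜ ∈ {Z | ∃ S, Z = zeros S} ↔ _
  rw [compl_compl]
  rfl

/-- The `f`-values `f k = b k * c k`. -/
def f (p : DHParam) (k : ZMod 6) : ℝ := p.b k * p.c k

open Polynomial in
/-- The invariant quad polynomial `Q_k^+`, in terms of the invariant parameters. -/
noncomputable def quadPlus (p : DHParam) (k : ZMod 6) : ℂ[X] :=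
  (X + C ((((p.f k - p.f (k + 2) - p.f (k + 3) + p.f (k + 5)) / 4 : ℝ) : ℂ)
      + Complex.I * (((p.s (k + 3) - p.s k) / 4 : ℝ) : ℂ))) ^ 2
  + C (((p.c (k + 1) / 2 * (p.b k * p.b (k + 2) - p.s (k + 1) * p.s (k + 2))
        - (p.b k ^ 2 + p.b (k + 2) ^ 2 - p.b (k + 1) ^ 2 + p.f (k + 1) ^ 2
            - p.s (k + 1) ^ 2 - p.s (k + 2) ^ 2) / 4 : ℝ) : ℂ)
      + Complex.I * (((p.s (k + 1) * (p.b k - p.b (k + 2) * p.c (k + 1))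
        + p.s (k + 2) * (p.b (k + 2) - p.b k * p.c (k + 1))) / 2 : ℝ) : ℂ))

/-- The substitution `b k ↦ -b k`, `c k ↦ -c k`, `s k ↦ (-1)^k * s k`, which is the effect of
reversing the orientation of the first, third and fifth axis. -/
def flip (p : DHParam) : DHParam where
  b k := -p.b k
  c k := -p.c k
  s k := (-1) ^ k.val * p.s k

/-- The invariant quad polynomial `Q_k^-`. -/
noncomputable def quadMinus (p : DHParam) (k : ZMod 6) : Polynomial ℂ := p.flip.quadPlus k

/-- The six equalities of polynomials `Q_k^± = Q_{k+3}^±`, `k = 1, 2, 3`. -/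
def QuadEqualities (p : DHParam) : Prop :=
  p.quadPlus 1 = p.quadPlus 4 ∧ p.quadPlus 2 = p.quadPlus 5 ∧ p.quadPlus 3 = p.quadPlus 6 ∧
  p.quadMinus 1 = p.quadMinus 4 ∧ p.quadMinus 2 = p.quadMinus 5 ∧ p.quadMinus 3 = p.quadMinus 6

/-- The 24 real equations: equality of the real and of the imaginary parts of the constant and of
the linear coefficients (`j = 0, 1`) of `Q_k^±` and `Q_{k+3}^±`, for `k = 1, 2, 3`. -/
def Equations24 (p : DHParam) : Prop :=
  ∀ k ∈ ({1, 2, 3} : Set (ZMod 6)), ∀ j ∈ ({0, 1} : Set ℕ),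
    ((p.quadPlus k).coeff j).re = ((p.quadPlus (k + 3)).coeff j).re ∧
    ((p.quadPlus k).coeff j).im = ((p.quadPlus (k + 3)).coeff j).im ∧
    ((p.quadMinus k).coeff j).re = ((p.quadMinus (k + 3)).coeff j).re ∧
    ((p.quadMinus k).coeff j).im = ((p.quadMinus (k + 3)).coeff j).im

/-- The standing assumptions on a linkage: no two adjacent axes are parallel, and all coupling
dimensions `l_{k,k+1,k+2}` are equal to 8, i.e. for no `k` we have both `s (k+1) = 0` and
`b k ^ 2 = b (k+1) ^ 2`. -/
def Admissible (p : DHParam) : Prop :=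
  (∀ k, -1 < p.c k ∧ p.c k < 1) ∧ ∀ k, ¬ (p.s (k + 1) = 0 ∧ p.b k ^ 2 = p.b (k + 1) ^ 2)

/-- The zero set of the 24 equations (among the parameters satisfying the standing assumptions). -/
def solutionSet : Set DHParam := {p | p.Admissible ∧ p.Equations24}

/-- The three equations common to both components. -/
def Red (p : DHParam) : Prop :=
  p.b 1 * p.c 2 * p.b 3 = p.b 4 * p.c 5 * p.b 6 ∧
  p.b 2 * p.c 3 * p.b 4 = p.b 5 * p.c 6 * p.b 1 ∧
  p.b 3 * p.c 4 * p.b 5 = p.b 6 * p.c 1 * p.b 2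

/-- The equations specific to the first component. -/
def Family1 (p : DHParam) : Prop :=
  p.f 1 = p.f 4 ∧ p.f 2 = p.f 5 ∧ p.f 3 = p.f 6 ∧
  p.b 1 * p.b 3 * p.b 5 = p.b 2 * p.b 4 * p.b 6 ∧
  p.b 1 ^ 2 + p.b 3 ^ 2 + p.b 5 ^ 2 = p.b 2 ^ 2 + p.b 4 ^ 2 + p.b 6 ^ 2

/-- The equations specific to the second component. -/
def Family2 (p : DHParam) : Prop :=
  p.f 1 = p.f 3 ∧ p.f 3 = p.f 5 ∧ p.f 2 = p.f 4 ∧ p.f 4 = p.f 6 ∧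
  p.b 1 * p.b 3 * p.b 5 * p.f 2 = p.b 2 * p.b 4 * p.b 6 * p.f 1 ∧
  p.b 1 ^ 2 + p.b 3 ^ 2 + p.b 5 ^ 2 + p.f 2 ^ 2 = p.b 2 ^ 2 + p.b 4 ^ 2 + p.b 6 ^ 2 + p.f 1 ^ 2

/-- The first component, in all of `ℝ¹⁸`. -/
def component1 : Set DHParam := {p | (∀ k, p.s k = 0) ∧ p.Red ∧ p.Family1}

/-- The second component, in all of `ℝ¹⁸`. -/
def component2 : Set DHParam := {p | (∀ k, p.s k = 0) ∧ p.Red ∧ p.Family2}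

end DHParam

/-! For (a), compare each equation for `quadPlus` with its `quadMinus` counterpart. The linear
coefficients give `s k = s (k+3)` and `s k = -s (k+3)`, so all offsets vanish, and they also give
linear relations among the `f`-values. In the constant coefficients the cubic term `b c b` is odd
under `flip` and the rest is even. Sums and differences therefore separate `Red` from three
quadratic relations. The case distinction `f 1 = f 4` or not then yields the two families
(`equations24_iff_components`).

For (b), each component is parametrized by a double cover `N e² = G` of an affine space, with all
coordinates affine in `e`. Up to powers of `N`, a polynomial pulls back to `A + B e`. If a product
vanishes on the component, then `A + B e` times `C + D e` vanishes on both real sheets over an open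
set, which makes one factor zero unless `G / N` is a square. A point with `N G < 0` excludes a
square, since then `(N A)² = N G B²` forces `A = B = 0` nearby (`isIrreducible_of_double_cover`). It
remains to show that the cover is dense enough. For the second component it reaches every admissible
point (`exists_cover2_eq`). For the first it misses only the points with `b₂ = b₅ = 0`, which are
limits of curves in the cover (`exists_cover1_eq`, `eval_coords_eq_zero_of_cover1`). -/

open MvPolynomial Topology Filter in
/-- A real polynomial that vanishes near a point is zero. -/
theorem MvPolynomial.eq_zero_of_eventually_eval_eq_zero {n : ℕ} {P : MvPolynomial (Fin n) ℝ}
    {x₀ : Fin n → ℝ} (h : ∀ᶠ x in 𝓝 x₀, eval x P = 0) : P = 0 := by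
  obtain ⟨ε, hε, h⟩ := Metric.eventually_nhds_iff_ball.1 h
  -- A sup-norm ball is a product of infinite sets, and a polynomial vanishing on such a product is
  -- zero.
  refine MvPolynomial.funext_set (fun i => Metric.ball (x₀ i) ε) (fun i => ?_) fun x hx => ?_
  · rw [Real.ball_eq_Ioo]
    exact (Set.Ioo_infinite (by linarith))
  · rw [map_zero]
    refine h x ?_
    rw [ball_pi _ hε]
    exact hx

/-! ### Irreducibility from real double covers -/

namespace DHParam

open MvPolynomial Topology Filter

/-- On a double cover `N e² = G`, a polynomial in coordinates that are affine in `e` becomes affine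
in `e` after clearing denominators. -/
theorem exists_affine_of_coords_affine {n : ℕ} {N G : MvPolynomial (Fin n) ℝ}
    {Φ : (Fin n → ℝ) → ℝ → DHParam}
    (hΦ : ∀ j, ∃ A B : MvPolynomial (Fin n) ℝ, ∀ x e,
      (Φ x e).coords j = eval x A + eval x B * e)
    (P : MvPolynomial (ZMod 6 ⊕ ZMod 6 ⊕ ZMod 6) ℝ) :
    ∃ (k : ℕ) (A B : MvPolynomial (Fin n) ℝ), ∀ x e, eval x N * e ^ 2 = eval x G →
      eval x N ^ k * eval (Φ x e).coords P = eval x A + eval x B * e := by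
  induction P using MvPolynomial.induction_on with
  | C a => exact ⟨0, C a, 0, fun x e _ => by simp⟩
  | add p q hp hq =>
    obtain ⟨k, A, B, h⟩ := hp
    obtain ⟨l, A', B', h'⟩ := hq
    refine ⟨k + l, N ^ l * A + N ^ k * A', N ^ l * B + N ^ k * B', fun x e he => ?_⟩
    simp only [map_add, map_mul, map_pow]
    linear_combination eval x N ^ l * h x e he + eval x N ^ k * h' x e he
  | mul_X p j hp =>
    obtain ⟨k, A, B, h⟩ := hp
    obtain ⟨a, b, h'⟩ := hΦ j
    refine ⟨k + 1, N * A * a + B * b * G, N * (A * b + B * a), fun x e he => ?_⟩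
    simp only [map_add, map_mul, eval_X, h']
    linear_combination eval x N * (eval x a + eval x b * e) * h x e he
      + eval x B * eval x b * he

/-- Irreducibility of a set that is dominated by a double cover `N e² = G` whose two sheets are real
somewhere and nonreal somewhere else. -/
theorem isIrreducible_of_double_cover {n : ℕ} {N G : MvPolynomial (Fin n) ℝ}
    {Φ : (Fin n → ℝ) → ℝ → DHParam} {T : Set DHParam}
    (hΦ : ∀ j, ∃ A B : MvPolynomial (Fin n) ℝ, ∀ x e,
      (Φ x e).coords j = eval x A + eval x B * e)
    (hT : T.Nonempty)
    (hreal : ∃ x₀, ∀ᶠ x in 𝓝 x₀, 0 < eval x N * eval x G ∧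
      ∀ e, eval x N * e ^ 2 = eval x G → Φ x e ∈ T)
    (himag : ∃ x, eval x N * eval x G < 0)
    (hdense : ∀ P, (∀ x e, eval x N ≠ 0 → eval x N * e ^ 2 = eval x G →
      eval (Φ x e).coords P = 0) → ∀ p ∈ T, eval p.coords P = 0) :
    IsIrreducible T := by
  refine ⟨hT, isPreirreducible_iff_isClosed_union_isClosed.2 fun Z₁ Z₂ hZ₁ hZ₂ hZ => ?_⟩
  obtain ⟨S₁, rfl⟩ := (isClosed_iff_zeros _).1 hZ₁
  obtain ⟨S₂, rfl⟩ := (isClosed_iff_zeros _).1 hZ₂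
  have main : ∀ P Q, (∀ p ∈ T, eval p.coords P * eval p.coords Q = 0) →
      (∀ p ∈ T, eval p.coords P = 0) ∨ ∀ p ∈ T, eval p.coords Q = 0 := by
    intro P Q hPQ
    obtain ⟨k, A, B, hP⟩ := exists_affine_of_coords_affine (N := N) (G := G) hΦ P
    obtain ⟨l, C, D, hQ⟩ := exists_affine_of_coords_affine (N := N) (G := G) hΦ Q
    have vanish : ∀ (k : ℕ) (R A B : MvPolynomial _ ℝ), (∀ x e, eval x N * e ^ 2 = eval x G →
        eval x N ^ k * eval (Φ x e).coords R = eval x A + eval x B * e) → A = 0 → B = 0 →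
        ∀ p ∈ T, eval p.coords R = 0 := by
      rintro k R A B h rfl rfl
      refine hdense R fun x e hN he => ?_
      have := h x e he
      simpa [hN] using this
    obtain ⟨x₀, hreal⟩ := hreal
    -- Half the sum and half the difference of the product relations on the sheets `e` and `-e`,
    -- with `e²` eliminated.
    have hrel : ∀ᶠ x in 𝓝 x₀, eval x (N * (A * C) + B * D * G) = 0 ∧
        eval x (A * D + B * C) = 0 := by
      filter_upwards [hreal] with x hx
      obtain ⟨hpos, hx⟩ := hx
      have hN : eval x N ≠ 0 := left_ne_zero_of_mul hpos.ne'
      have hq : 0 < eval x G / eval x N := by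
        rw [div_eq_mul_inv, ← mul_inv_cancel_right₀ hN (eval x G), mul_assoc, mul_assoc]
        rw [show eval x G * (eval x N * ((eval x N)⁻¹ * (eval x N)⁻¹)) =
          eval x N * eval x G * ((eval x N)⁻¹ * (eval x N)⁻¹) by ring]
        exact mul_pos hpos (mul_self_pos.2 (inv_ne_zero hN))
      set e := Real.sqrt (eval x G / eval x N) with he_def
      have he0 : e ≠ 0 := (Real.sqrt_pos.2 hq).ne'
      have he : eval x N * e ^ 2 = eval x G := by
        rw [Real.sq_sqrt hq.le, mul_div_cancel₀ _ hN]
      have he' : eval x N * (-e) ^ 2 = eval x G := by rw [neg_sq, he]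
      have h₁ : (eval x A + eval x B * e) * (eval x C + eval x D * e) = 0 := by
        rw [← hP x e he, ← hQ x e he]
        linear_combination eval x N ^ k * eval x N ^ l * hPQ _ (hx e he)
      have h₂ : (eval x A + eval x B * -e) * (eval x C + eval x D * -e) = 0 := by
        rw [← hP x _ he', ← hQ x _ he']
        linear_combination eval x N ^ k * eval x N ^ l * hPQ _ (hx _ he')
      simp only [map_add, map_mul]
      constructor
      · linear_combination eval x N / 2 * (h₁ + h₂) - eval x B * eval x D * he
      · refine (mul_eq_zero.1 (?_ : _ * e = 0)).resolve_right he0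
        linear_combination (h₁ - h₂) / 2
    have r₁ := eq_zero_of_eventually_eval_eq_zero (hrel.mono fun _ h => h.1)
    have r₂ := eq_zero_of_eventually_eval_eq_zero (hrel.mono fun _ h => h.2)
    obtain ⟨x₁, himag⟩ := himag
    have hN0 : N ≠ 0 := by
      rintro rfl
      simp at himag
    -- Eliminating `C` leaves the norm of `A + B e`. If `D = 0`, the two relations become `N A C =
    -- 0` and `B C = 0`.
    have key : D * (N * A ^ 2 - G * B ^ 2) = 0 := by
      linear_combination N * A * r₂ - B * r₁
    rcases mul_eq_zero.1 key with rfl | key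
    · by_cases hC : C = 0
      · exact Or.inr (vanish l Q C 0 hQ hC rfl)
      · left
        refine vanish k P A B hP ?_ ?_
        · simpa [hN0, hC] using r₁
        · simpa [hC] using r₂
    · left
      have hcont : ∀ᶠ x in 𝓝 x₁, eval x N * eval x G < 0 :=
        ((MvPolynomial.continuous_eval N).mul (MvPolynomial.continuous_eval G)).continuousAt.eventually
          (gt_mem_nhds himag)
      have hAB : ∀ᶠ x in 𝓝 x₁, eval x A = 0 ∧ eval x B = 0 := by
        filter_upwards [hcont] with x hx
        have hk := congrArg (eval x) key
        simp only [map_sub, map_mul, map_pow, map_zero] at hk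
        have hN : eval x N ≠ 0 := left_ne_zero_of_mul hx.ne
        -- A square equals a negative number times a square, so both squares vanish.
        have hs : (eval x N * eval x A) ^ 2 = eval x N * eval x G * eval x B ^ 2 := by
          linear_combination eval x N * hk
        have hB : eval x B = 0 := by
          by_contra hB
          have := mul_neg_of_neg_of_pos hx (pow_pos (abs_pos.2 hB) 2)
          rw [sq_abs, ← hs] at this
          exact absurd this (not_lt.2 (sq_nonneg _))
        rw [hB] at hs
        exact ⟨by simpa [hN] using hs, hB⟩
      exact vanish k P A B hP (eq_zero_of_eventually_eval_eq_zero (hAB.mono fun _ h => h.1))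
        (eq_zero_of_eventually_eval_eq_zero (hAB.mono fun _ h => h.2))
  by_contra hn
  simp only [not_or, Set.not_subset, zeros, Set.mem_ofPred_eq, not_forall] at hn
  obtain ⟨⟨p, hp, P, hP, hP0⟩, q, hq, Q, hQ, hQ0⟩ := hn
  have hPQ : ∀ r ∈ T, eval r.coords P * eval r.coords Q = 0 := by
    intro r hr
    rcases hZ hr with h | h
    · rw [h P hP, zero_mul]
    · rw [h Q hQ, mul_zero]
  rcases main P Q hPQ with h | h
  · exact hP0 (h p hp)
  · exact hQ0 (h q hq)

/-- A polynomial that vanishes along a punctured curve vanishes at its limit point. -/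
theorem eval_coords_eq_zero_of_tendsto {P : MvPolynomial (ZMod 6 ⊕ ZMod 6 ⊕ ZMod 6) ℝ}
    {γ : ℝ → DHParam} {p : DHParam} (hb : ∀ k, Tendsto (fun t => (γ t).b k) (𝓝[≠] 0) (𝓝 (p.b k)))
    (hc : ∀ k, Tendsto (fun t => (γ t).c k) (𝓝[≠] 0) (𝓝 (p.c k)))
    (hs : ∀ k, Tendsto (fun t => (γ t).s k) (𝓝[≠] 0) (𝓝 (p.s k)))
    (h : ∀ᶠ t in 𝓝[≠] 0, eval (γ t).coords P = 0) : eval p.coords P = 0 := by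
  -- The limit is taken in the Euclidean topology of the coordinate space, because `DHParam` itself
  -- carries the Zariski topology.
  have hco : Tendsto (fun t => (γ t).coords) (𝓝[≠] 0) (𝓝 p.coords) := by
    refine tendsto_pi_nhds.2 ?_
    rintro (k | k | k)
    · exact hb k
    · exact hc k
    · exact hs k
  exact tendsto_nhds_unique
    (((MvPolynomial.continuous_eval P).tendsto _).comp hco)
    (tendsto_const_nhds.congr' (h.mono fun t ht => ht.symm))

end DHParam

/-! ### Solving the 24 equations -/

namespace DHParam

theorem forall_zmod_six {p : ZMod 6 → Prop} :
    (∀ k, p k) ↔ p 1 ∧ p 2 ∧ p 3 ∧ p 4 ∧ p 5 ∧ p 6 := by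
  refine ⟨fun h => ⟨h _, h _, h _, h _, h _, h _⟩, ?_⟩
  rintro ⟨h1, h2, h3, h4, h5, h6⟩ k
  fin_cases k
  exacts [h6, h1, h2, h3, h4, h5]

open Polynomial in
theorem coeff_sq_add_C (a b : ℂ) :
    ((X + C a) ^ 2 + C b : ℂ[X]).coeff 0 = a ^ 2 + b ∧
    ((X + C a) ^ 2 + C b : ℂ[X]).coeff 1 = 2 * a := by
  have h : ((X + C a) ^ 2 + C b : ℂ[X]) = C 1 * X ^ 2 + C (2 * a) * X + C (a ^ 2 + b) := by
    simp only [map_add, map_mul, map_pow, map_one, map_ofNat]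
    ring
  rw [h]
  generalize a ^ 2 + b = d
  constructor
  · simp
  · simp [coeff_C, coeff_X_pow]

open Polynomial in
theorem sq_add_C_inj {a b a' b' : ℂ} :
    ((X + C a) ^ 2 + C b : ℂ[X]) = (X + C a') ^ 2 + C b' ↔
      ((X + C a) ^ 2 + C b : ℂ[X]).coeff 0 = ((X + C a') ^ 2 + C b').coeff 0 ∧
      ((X + C a) ^ 2 + C b : ℂ[X]).coeff 1 = ((X + C a') ^ 2 + C b').coeff 1 := by
  refine ⟨fun h => by rw [h]; exact ⟨rfl, rfl⟩, ?_⟩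
  rw [(coeff_sq_add_C a b).1, (coeff_sq_add_C a b).2, (coeff_sq_add_C a' b').1,
    (coeff_sq_add_C a' b').2]
  rintro ⟨h0, h1⟩
  obtain rfl : a = a' := mul_left_cancel₀ two_ne_zero h1
  rw [add_left_cancel h0]

theorem quadPlus_eq_iff (p q : DHParam) (k l : ZMod 6) :
    p.quadPlus k = q.quadPlus l ↔ (p.quadPlus k).coeff 0 = (q.quadPlus l).coeff 0 ∧
      (p.quadPlus k).coeff 1 = (q.quadPlus l).coeff 1 := sq_add_C_inj

theorem quadEqualities_iff_equations24 (p : DHParam) : p.QuadEqualities ↔ p.Equations24 := by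
  have e1 : (1 + 3 : ZMod 6) = 4 := rfl
  have e2 : (2 + 3 : ZMod 6) = 5 := rfl
  have e3 : (3 + 3 : ZMod 6) = 6 := rfl
  simp only [QuadEqualities, Equations24, quadMinus, quadPlus_eq_iff, Complex.ext_iff,
    Set.mem_insert_iff, Set.mem_singleton_iff, forall_eq_or_imp, forall_eq, e1, e2, e3]
  constructor
  · rintro ⟨⟨⟨p1, p2⟩, p3, p4⟩, ⟨⟨q1, q2⟩, q3, q4⟩, ⟨⟨r1, r2⟩, r3, r4⟩, ⟨⟨u1, u2⟩, u3, u4⟩,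
      ⟨⟨v1, v2⟩, v3, v4⟩, ⟨w1, w2⟩, w3, w4⟩
    exact ⟨⟨⟨p1, p2, u1, u2⟩, p3, p4, u3, u4⟩, ⟨⟨q1, q2, v1, v2⟩, q3, q4, v3, v4⟩,
      ⟨r1, r2, w1, w2⟩, r3, r4, w3, w4⟩
  · rintro ⟨⟨⟨p1, p2, u1, u2⟩, p3, p4, u3, u4⟩, ⟨⟨q1, q2, v1, v2⟩, q3, q4, v3, v4⟩,
      ⟨r1, r2, w1, w2⟩, r3, r4, w3, w4⟩
    exact ⟨⟨⟨p1, p2⟩, p3, p4⟩, ⟨⟨q1, q2⟩, q3, q4⟩, ⟨⟨r1, r2⟩, r3, r4⟩, ⟨⟨u1, u2⟩, u3, u4⟩,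
      ⟨⟨v1, v2⟩, v3, v4⟩, ⟨w1, w2⟩, w3, w4⟩

/-- The real and imaginary parts of the shift and the constant term of `Q_k^+`. -/
theorem quadPlus_coeff (p : DHParam) (k : ZMod 6) :
    ((p.quadPlus k).coeff 1).re = (p.f k - p.f (k + 2) - p.f (k + 3) + p.f (k + 5)) / 2 ∧
    ((p.quadPlus k).coeff 1).im = (p.s (k + 3) - p.s k) / 2 ∧
    ((p.quadPlus k).coeff 0).re = ((p.f k - p.f (k + 2) - p.f (k + 3) + p.f (k + 5)) / 4) ^ 2
      - ((p.s (k + 3) - p.s k) / 4) ^ 2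
      + (p.c (k + 1) / 2 * (p.b k * p.b (k + 2) - p.s (k + 1) * p.s (k + 2))
        - (p.b k ^ 2 + p.b (k + 2) ^ 2 - p.b (k + 1) ^ 2 + p.f (k + 1) ^ 2
            - p.s (k + 1) ^ 2 - p.s (k + 2) ^ 2) / 4) ∧
    ((p.quadPlus k).coeff 0).im = 2 * ((p.f k - p.f (k + 2) - p.f (k + 3) + p.f (k + 5)) / 4)
      * ((p.s (k + 3) - p.s k) / 4)
      + (p.s (k + 1) * (p.b k - p.b (k + 2) * p.c (k + 1))
        + p.s (k + 2) * (p.b (k + 2) - p.b k * p.c (k + 1))) / 2 := by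
  unfold quadPlus
  rw [(coeff_sq_add_C _ _).1, (coeff_sq_add_C _ _).2]
  simp only [pow_two, Complex.add_re, Complex.add_im, Complex.mul_re, Complex.mul_im,
    Complex.ofReal_re, Complex.ofReal_im, Complex.I_re, Complex.I_im, Complex.re_ofNat,
    Complex.im_ofNat]
  refine ⟨?_, ?_, ?_, ?_⟩ <;> ring

theorem flip_f (p : DHParam) (k : ZMod 6) : p.flip.f k = p.f k := neg_mul_neg _ _

/-- Everything reduces to elimination in 18 real variables. No standing assumption is needed, since
the only divisions are by differences that a case split makes nonzero. -/
theorem equations24_iff_components (p : DHParam) :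
    p.Equations24 ↔ (∀ k, p.s k = 0) ∧ p.Red ∧ (p.Family1 ∨ p.Family2) := by
  have a11 : (1 + 1 : ZMod 6) = 2 := rfl
  have a12 : (1 + 2 : ZMod 6) = 3 := rfl
  have a13 : (1 + 3 : ZMod 6) = 4 := rfl
  have a15 : (1 + 5 : ZMod 6) = 6 := rfl
  have a21 : (2 + 1 : ZMod 6) = 3 := rfl
  have a22 : (2 + 2 : ZMod 6) = 4 := rfl
  have a23 : (2 + 3 : ZMod 6) = 5 := rfl
  have a25 : (2 + 5 : ZMod 6) = 1 := rfl
  have a31 : (3 + 1 : ZMod 6) = 4 := rfl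
  have a32 : (3 + 2 : ZMod 6) = 5 := rfl
  have a33 : (3 + 3 : ZMod 6) = 6 := rfl
  have a35 : (3 + 5 : ZMod 6) = 2 := rfl
  have a41 : (4 + 1 : ZMod 6) = 5 := rfl
  have a42 : (4 + 2 : ZMod 6) = 6 := rfl
  have a43 : (4 + 3 : ZMod 6) = 1 := rfl
  have a45 : (4 + 5 : ZMod 6) = 3 := rfl
  have a51 : (5 + 1 : ZMod 6) = 6 := rfl
  have a52 : (5 + 2 : ZMod 6) = 1 := rfl
  have a53 : (5 + 3 : ZMod 6) = 2 := rfl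
  have a55 : (5 + 5 : ZMod 6) = 4 := rfl
  have a61 : (6 + 1 : ZMod 6) = 1 := rfl
  have a62 : (6 + 2 : ZMod 6) = 2 := rfl
  have a63 : (6 + 3 : ZMod 6) = 3 := rfl
  have a65 : (6 + 5 : ZMod 6) = 5 := rfl
  have v1 : (1 : ZMod 6).val = 1 := rfl
  have v2 : (2 : ZMod 6).val = 2 := rfl
  have v3 : (3 : ZMod 6).val = 3 := rfl
  have v4 : (4 : ZMod 6).val = 4 := rfl
  have v5 : (5 : ZMod 6).val = 5 := rfl
  have v6 : (6 : ZMod 6).val = 0 := rfl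
  simp only [Equations24, quadMinus, (quadPlus_coeff _ _).1, (quadPlus_coeff _ _).2.1,
    (quadPlus_coeff _ _).2.2.1, (quadPlus_coeff _ _).2.2.2, flip_f,
    Set.mem_insert_iff, Set.mem_singleton_iff, forall_eq_or_imp, forall_eq, forall_zmod_six,
    a11, a12, a13, a15, a21, a22, a23, a25, a31, a32, a33, a35, a41, a42, a43, a45, a51, a52, a53,
    a55, a61, a62, a63, a65]
  simp only [flip, v1, v2, v3, v4, v5, v6]
  unfold Red Family1 Family2
  -- The `f`-values become variables of their own, tied to `b` and `c` only by these equations, so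
  -- relations linear in them stay visible to `linarith`.
  have hf1 : p.f 1 = p.b 1 * p.c 1 := rfl
  have hf2 : p.f 2 = p.b 2 * p.c 2 := rfl
  have hf3 : p.f 3 = p.b 3 * p.c 3 := rfl
  have hf4 : p.f 4 = p.b 4 * p.c 4 := rfl
  have hf5 : p.f 5 = p.b 5 * p.c 5 := rfl
  have hf6 : p.f 6 = p.b 6 * p.c 6 := rfl
  revert hf1 hf2 hf3 hf4 hf5 hf6
  generalize p.b 1 = b1
  generalize p.b 2 = b2
  generalize p.b 3 = b3
  generalize p.b 4 = b4
  generalize p.b 5 = b5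
  generalize p.b 6 = b6
  generalize p.c 1 = c1
  generalize p.c 2 = c2
  generalize p.c 3 = c3
  generalize p.c 4 = c4
  generalize p.c 5 = c5
  generalize p.c 6 = c6
  generalize p.s 1 = s1
  generalize p.s 2 = s2
  generalize p.s 3 = s3
  generalize p.s 4 = s4
  generalize p.s 5 = s5
  generalize p.s 6 = s6
  generalize p.f 1 = f1
  generalize p.f 2 = f2
  generalize p.f 3 = f3
  generalize p.f 4 = f4
  generalize p.f 5 = f5
  generalize p.f 6 = f6
  clear a11 a12 a13 a15 a21 a22 a23 a25 a31 a32 a33 a35 a41 a42 a43 a45 a51 a52 a53 a55 a61 a62 a63 a65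
    v1 v2 v3 v4 v5 v6
  intro hf1 hf2 hf3 hf4 hf5 hf6
  constructor
  · rintro ⟨⟨⟨p1, p2, p3, p4⟩, l1, l2, l3, l4⟩, ⟨⟨q1, q2, q3, q4⟩, m1, m2, m3, m4⟩,
      ⟨r1, r2, r3, r4⟩, n1, n2, n3, n4⟩
    -- The imaginary linear coefficients give `s1 = s4` for the plus sign and `s1 = -s4` for the
    -- minus sign.
    have hs1 : s1 = 0 := by linarith only [l2, l4]
    have hs2 : s2 = 0 := by linarith only [m2, m4]
    have hs3 : s3 = 0 := by linarith only [n2, n4]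
    have hs4 : s4 = 0 := by linarith only [l2, l4]
    have hs5 : s5 = 0 := by linarith only [m2, m4]
    have hs6 : s6 = 0 := by linarith only [n2, n4]
    have t1 : f1 - f3 - f4 + f6 = 0 := by linarith only [l1]
    have t2 : f2 - f4 - f5 + f1 = 0 := by linarith only [m1]
    have t3 : f3 - f5 - f6 + f2 = 0 := by linarith only [n1]
    clear p2 p4 q2 q4 r2 r4 l1 l2 l3 l4 m1 m2 m3 m4 n1 n2 n3 n4
    have t1' : f4 - f6 - f1 + f3 = 0 := by linarith only [t1]
    have t2' : f5 - f1 - f2 + f4 = 0 := by linarith only [t2]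
    have t3' : f6 - f2 - f3 + f5 = 0 := by linarith only [t3]
    subst hs1 hs2 hs3 hs4 hs5 hs6
    rw [t1, t1'] at p1 p3
    rw [t2, t2'] at q1 q3
    rw [t3, t3'] at r1 r3
    refine ⟨⟨rfl, rfl, rfl, rfl, rfl, rfl⟩, ?_⟩
    -- With zero offsets and shifts, the plus and minus equations differ only in the sign of the `b
    -- c b` terms: their difference gives `R1`, their sum gives `S1`.
    have R1 : b1 * c2 * b3 = b4 * c5 * b6 := by linarith only [p1, p3]
    have R2 : b2 * c3 * b4 = b5 * c6 * b1 := by linarith only [q1, q3]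
    have R3 : b3 * c4 * b5 = b6 * c1 * b2 := by linarith only [r1, r3]
    refine ⟨⟨R1, R2, R3⟩, ?_⟩
    have S1 : b1 ^ 2 + b3 ^ 2 - b2 ^ 2 + f2 ^ 2 =
      b4 ^ 2 + b6 ^ 2 - b5 ^ 2 + f5 ^ 2 := by linarith only [p1, p3]
    have S2 : b2 ^ 2 + b4 ^ 2 - b3 ^ 2 + f3 ^ 2 =
      b5 ^ 2 + b1 ^ 2 - b6 ^ 2 + f6 ^ 2 := by linarith only [q1, q3]
    have S3 : b3 ^ 2 + b5 ^ 2 - b4 ^ 2 + f4 ^ 2 =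
      b6 ^ 2 + b2 ^ 2 - b1 ^ 2 + f1 ^ 2 := by linarith only [r1, r3]
    clear p1 p3 q1 q3 r1 r3
    have F1 : b1 * b3 * b5 * f2 = b2 * b4 * b6 * f5 := by
      rw [hf2, hf5]
      linear_combination b2 * b5 * R1
    have F2 : b1 * b3 * b5 * f6 = b2 * b4 * b6 * f3 := by
      rw [hf3, hf6]
      linear_combination -b3 * b6 * R2
    have F3 : b1 * b3 * b5 * f4 = b2 * b4 * b6 * f1 := by
      rw [hf1, hf4]
      linear_combination b1 * b4 * R3
    by_cases hg : f1 = f4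
    · have h2 : f2 = f5 := by linarith
      have h3 : f3 = f6 := by linarith
      have hS : b1 ^ 2 + b3 ^ 2 + b5 ^ 2 = b2 ^ 2 + b4 ^ 2 + b6 ^ 2 := by
        rw [h2] at S1
        linarith
      by_cases hP : b1 * b3 * b5 = b2 * b4 * b6
      · exact Or.inl ⟨hg, h2, h3, hP, hS⟩
      -- If the two products differ, `F1`, `F2`, `F3` kill all `f`-values, and the point lies in the
      -- second family.
      · have hz : ∀ x : ℝ, b1 * b3 * b5 * x = b2 * b4 * b6 * x → x = 0 := by
          intro x hx
          by_contra h0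
          exact hP (mul_right_cancel₀ h0 hx)
        have z5 := hz (f5) (h2 ▸ F1)
        have z3 := hz (f3) (by rw [← h3] at F2; exact F2)
        have z1 := hz (f1) (by rw [← hg] at F3; exact F3)
        rw [z5] at h2
        rw [z3] at h3
        rw [z1] at hg
        refine Or.inr ⟨by rw [z1, z3], by rw [z3, z5], by rw [h2, ← hg], by rw [← hg, ← h3], ?_, ?_⟩
        · rw [h2, z1, mul_zero, mul_zero]
        · rw [h2, z1, hS]
    · right
      have hg' : f1 - f4 ≠ 0 := sub_ne_zero.2 hg
      -- `S2 + S3` says `f1² - f4² = f3² - f6²`, while `t1` says `f1 - f4 = f3 - f6`; cancel this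
      -- nonzero difference. Likewise for `u2`, where `f1 - f4 = f5 - f2`.
      have u1 : f1 + f4 = f3 + f6 := by
        refine mul_left_cancel₀ hg' ?_
        linear_combination -S2 - S3 - (f3 + f6) * t1
      have u2 : f1 + f4 = f2 + f5 := by
        refine mul_left_cancel₀ hg' ?_
        linear_combination S1 - S3 - (f2 + f5) * t2
      have h13 : f1 = f3 := by linarith
      have h35 : f3 = f5 := by linarith
      have h24 : f2 = f4 := by linarith
      have h46 : f4 = f6 := by linarith
      refine ⟨h13, h35, h24, h46, ?_, ?_⟩
      · rw [F1, h13, h35]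
      · rw [← h35, ← h13] at S1
        linarith
  · rintro ⟨⟨hs1, hs2, hs3, hs4, hs5, hs6⟩, ⟨R1, R2, R3⟩, h⟩
    subst hs1 hs2 hs3 hs4 hs5 hs6
    have key : f1 - f3 - f4 + f6 = 0 ∧ f2 - f4 - f5 + f1 = 0 ∧
        f3 - f5 - f6 + f2 = 0 ∧
        b1 ^ 2 + b3 ^ 2 - b2 ^ 2 + f2 ^ 2 =
          b4 ^ 2 + b6 ^ 2 - b5 ^ 2 + f5 ^ 2 ∧
        b2 ^ 2 + b4 ^ 2 - b3 ^ 2 + f3 ^ 2 =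
          b5 ^ 2 + b1 ^ 2 - b6 ^ 2 + f6 ^ 2 ∧
        b3 ^ 2 + b5 ^ 2 - b4 ^ 2 + f4 ^ 2 =
          b6 ^ 2 + b2 ^ 2 - b1 ^ 2 + f1 ^ 2 := by
      rcases h with ⟨h1, h2, h3, -, hS⟩ | ⟨h1, h2, h3, h4, -, hS⟩
      · rw [h1, h2, h3]
        refine ⟨?_, ?_, ?_, ?_, ?_, ?_⟩ <;> linarith
      · rw [h1, h3] at hS
        rw [h1, h3, ← h2, ← h4]
        rw [← h2, ← h4] at *
        refine ⟨?_, ?_, ?_, ?_, ?_, ?_⟩ <;> linarith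
    obtain ⟨t1, t2, t3, S1, S2, S3⟩ := key
    have t1' : f4 - f6 - f1 + f3 = 0 := by linarith only [t1]
    have t2' : f5 - f1 - f2 + f4 = 0 := by linarith only [t2]
    have t3' : f6 - f2 - f3 + f5 = 0 := by linarith only [t3]
    rw [t1, t1', t2, t2', t3, t3']
    clear t1 t1' t2 t2' t3 t3' hf1 hf2 hf3 hf4 hf5 hf6 h
    refine ⟨⟨⟨?_, ?_, ?_, ?_⟩, ?_, ?_, ?_, ?_⟩, ⟨⟨?_, ?_, ?_, ?_⟩, ?_, ?_, ?_, ?_⟩,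
      ⟨?_, ?_, ?_, ?_⟩, ?_, ?_, ?_, ?_⟩ <;> linarith

theorem setOf_equations24 : {p : DHParam | p.Equations24} = component1 ∪ component2 := by
  ext p
  simp only [Set.mem_union, Set.mem_ofPred_eq, component1, component2, equations24_iff_components]
  tauto

/-- Either family implies `b₁b₃b₅f₂ = b₂b₄b₆f₅` and its two analogues. These are the equations of
`Red` multiplied by `b₂b₅`, `b₃b₆`, `b₁b₄`. -/
theorem red_of_family (p : DHParam) (hb : ∀ k, p.b k ≠ 0) (h : p.Family1 ∨ p.Family2) :
    p.Red := by
  have hP : p.b 1 * p.b 3 * p.b 5 * p.f 2 = p.b 2 * p.b 4 * p.b 6 * p.f 5 ∧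
      p.b 1 * p.b 3 * p.b 5 * p.f 6 = p.b 2 * p.b 4 * p.b 6 * p.f 3 ∧
      p.b 1 * p.b 3 * p.b 5 * p.f 4 = p.b 2 * p.b 4 * p.b 6 * p.f 1 := by
    rcases h with ⟨h1, h2, h3, hP, -⟩ | ⟨h1, h2, h3, h4, hP, -⟩
    · rw [hP, h1, h2, h3]
      exact ⟨rfl, rfl, rfl⟩
    · rw [← h4, ← h3, ← h2, ← h1]
      exact ⟨hP, hP, hP⟩
  simp only [f] at hP
  obtain ⟨h1, h2, h3⟩ := hP
  refine ⟨mul_left_cancel₀ (mul_ne_zero (hb 2) (hb 5)) ?_,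
    mul_left_cancel₀ (mul_ne_zero (hb 3) (hb 6)) ?_,
    mul_left_cancel₀ (mul_ne_zero (hb 1) (hb 4)) ?_⟩
  · linear_combination h1
  · linear_combination -h2
  · linear_combination h3

end DHParam

/-! ### Irreducible components and subspaces -/

/-- A space that is the union of two closed irreducible sets, neither of which contains the other,
has exactly these two irreducible components. -/
theorem irreducibleComponents_eq_pair {X : Type*} [TopologicalSpace X] {A B : Set X}
    (hA : IsIrreducible A) (hB : IsIrreducible B) (cA : IsClosed A) (cB : IsClosed B)
    (h : A ∪ B = Set.univ) (hAB : ¬ A ⊆ B) (hBA : ¬ B ⊆ A) :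
    irreducibleComponents X = {A, B} := by
  have key : ∀ s : Set X, IsIrreducible s → s ⊆ A ∨ s ⊆ B := fun s hs =>
    isPreirreducible_iff_isClosed_union_isClosed.1 hs.2 A B cA cB (h ▸ Set.subset_univ s)
  ext s
  constructor
  · intro hs
    rcases key s hs.1 with h | h
    · exact Or.inl (h.antisymm (hs.2 hA h))
    · exact Or.inr (h.antisymm (hs.2 hB h))
  · rintro (rfl | rfl)
    · exact ⟨hA, fun t ht hst => (key t ht).resolve_right fun h => hAB (hst.trans h)⟩
    · exact ⟨hB, fun t ht hst => (key t ht).resolve_left fun h => hBA (hst.trans h)⟩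

theorem isIrreducible_preimage_val {X : Type*} [TopologicalSpace X] {S T : Set X}
    (h : IsIrreducible (S ∩ T)) : IsIrreducible (Subtype.val ⁻¹' T : Set S) := by
  obtain ⟨⟨x, hxS, hxT⟩, h⟩ := h
  refine ⟨⟨⟨x, hxS⟩, hxT⟩, isPreirreducible_iff_isClosed_union_isClosed.2 fun z₁ z₂ h₁ h₂ hz => ?_⟩
  obtain ⟨w₁, c₁, rfl⟩ := isClosed_induced_iff.1 h₁
  obtain ⟨w₂, c₂, rfl⟩ := isClosed_induced_iff.1 h₂
  exact (isPreirreducible_iff_isClosed_union_isClosed.1 h w₁ w₂ c₁ c₂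
    fun y hy => hz (a := ⟨y, hy.1⟩) hy.2).imp (fun h y hy => h ⟨y.2, hy⟩) fun h y hy => h ⟨y.2, hy⟩

/-! ### Regular points, explicit coordinates and closedness -/

namespace DHParam

open MvPolynomial Topology Filter

/-- The standing assumptions, for vanishing offsets. -/
def Regular (p : DHParam) : Prop :=
  (∀ k, -1 < p.c k ∧ p.c k < 1) ∧ ∀ k, p.b k ^ 2 ≠ p.b (k + 1) ^ 2

theorem admissible_iff_regular {p : DHParam} (h : ∀ k, p.s k = 0) : p.Admissible ↔ p.Regular := by
  simp only [Admissible, Regular, h, true_and, ne_eq]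

theorem solutionSet_inter_component1 :
    solutionSet ∩ component1 = {p | p ∈ component1 ∧ p.Regular} := by
  ext p
  constructor
  · rintro ⟨h, h'⟩
    exact ⟨h', (admissible_iff_regular h'.1).1 h.1⟩
  · rintro ⟨h, h'⟩
    exact ⟨⟨(admissible_iff_regular h.1).2 h',
      (equations24_iff_components p).2 ⟨h.1, h.2.1, Or.inl h.2.2⟩⟩, h⟩

theorem solutionSet_inter_component2 :
    solutionSet ∩ component2 = {p | p ∈ component2 ∧ p.Regular} := by
  ext p
  constructor
  · rintro ⟨h, h'⟩
    exact ⟨h', (admissible_iff_regular h'.1).1 h.1⟩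
  · rintro ⟨h, h'⟩
    exact ⟨⟨(admissible_iff_regular h.1).2 h',
      (equations24_iff_components p).2 ⟨h.1, h.2.1, Or.inr h.2.2⟩⟩, h⟩

/-- Strict inequalities are open in the Euclidean topology, hence continuity is imposed on `coords`
and not on `γ`. -/
theorem eventually_regular {X : Type*} [TopologicalSpace X] {γ : X → DHParam} {x₀ : X}
    (hγ : ContinuousAt (fun x => (γ x).coords) x₀) (h : (γ x₀).Regular) :
    ∀ᶠ x in 𝓝 x₀, (γ x).Regular := by
  have hc : ∀ k, ContinuousAt (fun x => (γ x).c k) x₀ := fun k =>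
    continuousAt_pi.1 hγ (Sum.inr (Sum.inl k))
  have hb : ∀ k, ContinuousAt (fun x => (γ x).b k) x₀ := fun k => continuousAt_pi.1 hγ (Sum.inl k)
  refine Filter.Eventually.and (eventually_all.2 fun k => ?_) (eventually_all.2 fun k => ?_)
  · exact ((hc k).eventually (lt_mem_nhds (h.1 k).1)).and
      ((hc k).eventually (gt_mem_nhds (h.1 k).2))
  · exact (((hb k).pow 2).prodMk ((hb (k + 1)).pow 2)).eventually
      (isOpen_ne_fun continuous_fst continuous_snd |>.mem_nhds (h.2 k))

/-- Regularity on both sheets of a double cover `N e² = G` is an open condition. -/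
theorem eventually_regular_double_cover {n : ℕ} {N G : MvPolynomial (Fin n) ℝ}
    {Φ : (Fin n → ℝ) → ℝ → DHParam}
    (hΦ : ∀ j, ∃ A B : MvPolynomial (Fin n) ℝ, ∀ x e,
      (Φ x e).coords j = eval x A + eval x B * e) {x₀ : Fin n → ℝ}
    (hpos : 0 < eval x₀ N * eval x₀ G)
    (h : ∀ e, eval x₀ N * e ^ 2 = eval x₀ G → (Φ x₀ e).Regular) :
    ∀ᶠ x in 𝓝 x₀, 0 < eval x N * eval x G ∧
      ∀ e, eval x N * e ^ 2 = eval x G → (Φ x e).Regular := by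
  have hN₀ : eval x₀ N ≠ 0 := left_ne_zero_of_mul hpos.ne'
  have cN := (MvPolynomial.continuous_eval N).continuousAt (x := x₀)
  have cG := (MvPolynomial.continuous_eval G).continuousAt (x := x₀)
  have ce : ContinuousAt (fun x => Real.sqrt (eval x G / eval x N)) x₀ :=
    (cG.div cN hN₀).sqrt
  have cΦ : ∀ g : (Fin n → ℝ) → ℝ, ContinuousAt g x₀ →
      ContinuousAt (fun x => (Φ x (g x)).coords) x₀ := by
    refine fun g hg => continuousAt_pi.2 fun j => ?_
    obtain ⟨A, B, hAB⟩ := hΦ j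
    simp only [hAB]
    exact (MvPolynomial.continuous_eval A).continuousAt.add
      ((MvPolynomial.continuous_eval B).continuousAt.mul hg)
  have pos_div : ∀ x, 0 < eval x N * eval x G → 0 < eval x G / eval x N := fun x hx => by
    rcases mul_pos_iff.1 hx with h | h
    · exact div_pos h.2 h.1
    · exact div_pos_of_neg_of_neg h.2 h.1
  have he : ∀ x, 0 < eval x N * eval x G →
      eval x N * Real.sqrt (eval x G / eval x N) ^ 2 = eval x G := fun x hx => by
    rw [Real.sq_sqrt (pos_div x hx).le, mul_div_cancel₀ _ (left_ne_zero_of_mul hx.ne')]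
  filter_upwards [(cN.mul cG).eventually (lt_mem_nhds hpos),
    eventually_regular (cΦ _ ce) (h _ (he x₀ hpos)),
    eventually_regular (cΦ _ ce.neg) (h _ (by rw [Pi.neg_apply, neg_sq]; exact he x₀ hpos))] with x h₀ h₁ h₂
  refine ⟨h₀, fun e hxe => ?_⟩
  have hsq : e ^ 2 = Real.sqrt (eval x G / eval x N) ^ 2 :=
    mul_left_cancel₀ (left_ne_zero_of_mul h₀.ne') (hxe.trans (he x h₀).symm)
  rcases sq_eq_sq_iff_eq_or_eq_neg.1 hsq with rfl | rfl
  · exact h₁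
  · exact h₂

/-- The cyclic family with the entries `a₁, …, a₆` at the indices `1, …, 6`. -/
def cyclicVec (a₁ a₂ a₃ a₄ a₅ a₆ : ℝ) (k : ZMod 6) : ℝ :=
  -- `a₆` comes first because the index 6 is 0.
  (![a₆, a₁, a₂, a₃, a₄, a₅] : Fin 6 → ℝ) k

/-- The parameters with given Bennett ratios and angle cosines and with vanishing offsets. -/
def ofRatios (b₁ b₂ b₃ b₄ b₅ b₆ c₁ c₂ c₃ c₄ c₅ c₆ : ℝ) : DHParam where
  b := cyclicVec b₁ b₂ b₃ b₄ b₅ b₆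
  c := cyclicVec c₁ c₂ c₃ c₄ c₅ c₆
  s _ := 0

theorem exists_ofRatios {p : DHParam} (h : ∀ k, p.s k = 0) :
    ∃ b₁ b₂ b₃ b₄ b₅ b₆ c₁ c₂ c₃ c₄ c₅ c₆, p = ofRatios b₁ b₂ b₃ b₄ b₅ b₆ c₁ c₂ c₃ c₄ c₅ c₆ := by
  refine ⟨p.b 1, p.b 2, p.b 3, p.b 4, p.b 5, p.b 6, p.c 1, p.c 2, p.c 3, p.c 4, p.c 5, p.c 6, ?_⟩
  ext k
  · revert k
    exact forall_zmod_six.2 ⟨rfl, rfl, rfl, rfl, rfl, rfl⟩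
  · revert k
    exact forall_zmod_six.2 ⟨rfl, rfl, rfl, rfl, rfl, rfl⟩
  · exact h k

section ofRatios

variable {b₁ b₂ b₃ b₄ b₅ b₆ c₁ c₂ c₃ c₄ c₅ c₆ : ℝ}

theorem ofRatios_mem_component1 :
    ofRatios b₁ b₂ b₃ b₄ b₅ b₆ c₁ c₂ c₃ c₄ c₅ c₆ ∈ component1 ↔
      (b₁ * c₂ * b₃ = b₄ * c₅ * b₆ ∧ b₂ * c₃ * b₄ = b₅ * c₆ * b₁ ∧ b₃ * c₄ * b₅ = b₆ * c₁ * b₂) ∧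
      b₁ * c₁ = b₄ * c₄ ∧ b₂ * c₂ = b₅ * c₅ ∧ b₃ * c₃ = b₆ * c₆ ∧
      b₁ * b₃ * b₅ = b₂ * b₄ * b₆ ∧ b₁ ^ 2 + b₃ ^ 2 + b₅ ^ 2 = b₂ ^ 2 + b₄ ^ 2 + b₆ ^ 2 :=
  ⟨fun h => h.2, fun h => ⟨fun _ => rfl, h⟩⟩

theorem ofRatios_mem_component2 :
    ofRatios b₁ b₂ b₃ b₄ b₅ b₆ c₁ c₂ c₃ c₄ c₅ c₆ ∈ component2 ↔
      (b₁ * c₂ * b₃ = b₄ * c₅ * b₆ ∧ b₂ * c₃ * b₄ = b₅ * c₆ * b₁ ∧ b₃ * c₄ * b₅ = b₆ * c₁ * b₂) ∧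
      b₁ * c₁ = b₃ * c₃ ∧ b₃ * c₃ = b₅ * c₅ ∧ b₂ * c₂ = b₄ * c₄ ∧ b₄ * c₄ = b₆ * c₆ ∧
      b₁ * b₃ * b₅ * (b₂ * c₂) = b₂ * b₄ * b₆ * (b₁ * c₁) ∧
      b₁ ^ 2 + b₃ ^ 2 + b₅ ^ 2 + (b₂ * c₂) ^ 2 = b₂ ^ 2 + b₄ ^ 2 + b₆ ^ 2 + (b₁ * c₁) ^ 2 :=
  ⟨fun h => h.2, fun h => ⟨fun _ => rfl, h⟩⟩

theorem ofRatios_regular :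
    (ofRatios b₁ b₂ b₃ b₄ b₅ b₆ c₁ c₂ c₃ c₄ c₅ c₆).Regular ↔
      ((-1 < c₁ ∧ c₁ < 1) ∧ (-1 < c₂ ∧ c₂ < 1) ∧ (-1 < c₃ ∧ c₃ < 1) ∧ (-1 < c₄ ∧ c₄ < 1) ∧
        (-1 < c₅ ∧ c₅ < 1) ∧ (-1 < c₆ ∧ c₆ < 1)) ∧
      b₁ ^ 2 ≠ b₂ ^ 2 ∧ b₂ ^ 2 ≠ b₃ ^ 2 ∧ b₃ ^ 2 ≠ b₄ ^ 2 ∧ b₄ ^ 2 ≠ b₅ ^ 2 ∧ b₅ ^ 2 ≠ b₆ ^ 2 ∧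
        b₆ ^ 2 ≠ b₁ ^ 2 :=
  and_congr forall_zmod_six forall_zmod_six

end ofRatios

/-- The set of all polynomials vanishing on the component serves as `S`; each defining equation is
one of its members, so a common zero satisfies them all. -/
theorem isClosed_component1 : IsClosed component1 := by
  refine (isClosed_iff_zeros _).2 ⟨{P | ∀ p ∈ component1, eval p.coords P = 0},
    Set.Subset.antisymm (fun p hp P hP => hP p hp) fun p hp => ?_⟩
  have key : ∀ F H : MvPolynomial (ZMod 6 ⊕ ZMod 6 ⊕ ZMod 6) ℝ,
      (∀ q ∈ component1, eval q.coords F = eval q.coords H) →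
      eval p.coords F = eval p.coords H := fun F H h => by
    have := hp (F - H) fun q hq => by rw [map_sub, h q hq, sub_self]
    rwa [map_sub, sub_eq_zero] at this
  let b : ZMod 6 → MvPolynomial (ZMod 6 ⊕ ZMod 6 ⊕ ZMod 6) ℝ := fun k => X (Sum.inl k)
  let c : ZMod 6 → MvPolynomial (ZMod 6 ⊕ ZMod 6 ⊕ ZMod 6) ℝ := fun k => X (Sum.inr (Sum.inl k))
  let s : ZMod 6 → MvPolynomial (ZMod 6 ⊕ ZMod 6 ⊕ ZMod 6) ℝ := fun k => X (Sum.inr (Sum.inr k))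
  have hb : ∀ q : DHParam, ∀ k, eval q.coords (b k) = q.b k := fun q k => eval_X _
  have hc : ∀ q : DHParam, ∀ k, eval q.coords (c k) = q.c k := fun q k => eval_X _
  have hs : ∀ q : DHParam, ∀ k, eval q.coords (s k) = q.s k := fun q k => eval_X _
  have h0 := fun k => key (s k) 0
  have h1 := key (b 1 * c 2 * b 3) (b 4 * c 5 * b 6)
  have h2 := key (b 2 * c 3 * b 4) (b 5 * c 6 * b 1)
  have h3 := key (b 3 * c 4 * b 5) (b 6 * c 1 * b 2)
  have h4 := key (b 1 * c 1) (b 4 * c 4)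
  have h5 := key (b 2 * c 2) (b 5 * c 5)
  have h6 := key (b 3 * c 3) (b 6 * c 6)
  have h7 := key (b 1 * b 3 * b 5) (b 2 * b 4 * b 6)
  have h8 := key (b 1 ^ 2 + b 3 ^ 2 + b 5 ^ 2) (b 2 ^ 2 + b 4 ^ 2 + b 6 ^ 2)
  simp only [map_add, map_mul, map_pow, map_zero, hb, hc, hs] at h0 h1 h2 h3 h4 h5 h6 h7 h8
  exact ⟨fun k => h0 k fun q hq => hq.1 k,
    ⟨h1 fun q hq => hq.2.1.1, h2 fun q hq => hq.2.1.2.1, h3 fun q hq => hq.2.1.2.2⟩,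
    h4 fun q hq => hq.2.2.1, h5 fun q hq => hq.2.2.2.1, h6 fun q hq => hq.2.2.2.2.1,
    h7 fun q hq => hq.2.2.2.2.2.1, h8 fun q hq => hq.2.2.2.2.2.2⟩

theorem isClosed_component2 : IsClosed component2 := by
  refine (isClosed_iff_zeros _).2 ⟨{P | ∀ p ∈ component2, eval p.coords P = 0},
    Set.Subset.antisymm (fun p hp P hP => hP p hp) fun p hp => ?_⟩
  have key : ∀ F H : MvPolynomial (ZMod 6 ⊕ ZMod 6 ⊕ ZMod 6) ℝ,
      (∀ q ∈ component2, eval q.coords F = eval q.coords H) →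
      eval p.coords F = eval p.coords H := fun F H h => by
    have := hp (F - H) fun q hq => by rw [map_sub, h q hq, sub_self]
    rwa [map_sub, sub_eq_zero] at this
  let b : ZMod 6 → MvPolynomial (ZMod 6 ⊕ ZMod 6 ⊕ ZMod 6) ℝ := fun k => X (Sum.inl k)
  let c : ZMod 6 → MvPolynomial (ZMod 6 ⊕ ZMod 6 ⊕ ZMod 6) ℝ := fun k => X (Sum.inr (Sum.inl k))
  let s : ZMod 6 → MvPolynomial (ZMod 6 ⊕ ZMod 6 ⊕ ZMod 6) ℝ := fun k => X (Sum.inr (Sum.inr k))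
  have hb : ∀ q : DHParam, ∀ k, eval q.coords (b k) = q.b k := fun q k => eval_X _
  have hc : ∀ q : DHParam, ∀ k, eval q.coords (c k) = q.c k := fun q k => eval_X _
  have hs : ∀ q : DHParam, ∀ k, eval q.coords (s k) = q.s k := fun q k => eval_X _
  have h0 := fun k => key (s k) 0
  have h1 := key (b 1 * c 2 * b 3) (b 4 * c 5 * b 6)
  have h2 := key (b 2 * c 3 * b 4) (b 5 * c 6 * b 1)
  have h3 := key (b 3 * c 4 * b 5) (b 6 * c 1 * b 2)
  have h4 := key (b 1 * c 1) (b 3 * c 3)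
  have h5 := key (b 3 * c 3) (b 5 * c 5)
  have h6 := key (b 2 * c 2) (b 4 * c 4)
  have h7 := key (b 4 * c 4) (b 6 * c 6)
  have h8 := key (b 1 * b 3 * b 5 * (b 2 * c 2)) (b 2 * b 4 * b 6 * (b 1 * c 1))
  have h9 := key (b 1 ^ 2 + b 3 ^ 2 + b 5 ^ 2 + (b 2 * c 2) ^ 2)
    (b 2 ^ 2 + b 4 ^ 2 + b 6 ^ 2 + (b 1 * c 1) ^ 2)
  simp only [map_add, map_mul, map_pow, map_zero, hb, hc, hs] at h0 h1 h2 h3 h4 h5 h6 h7 h8 h9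
  exact ⟨fun k => h0 k fun q hq => hq.1 k,
    ⟨h1 fun q hq => hq.2.1.1, h2 fun q hq => hq.2.1.2.1, h3 fun q hq => hq.2.1.2.2⟩,
    h4 fun q hq => hq.2.2.1, h5 fun q hq => hq.2.2.2.1, h6 fun q hq => hq.2.2.2.2.1,
    h7 fun q hq => hq.2.2.2.2.2.1, h8 fun q hq => hq.2.2.2.2.2.2.1,
    h9 fun q hq => hq.2.2.2.2.2.2.2⟩

end DHParam

/-! ### The first component -/

namespace DHParam

open MvPolynomial Topology Filter

/-- The points of the first component with given `b₂, b₃, b₄, b₅`, `c₂ / b₅`, `c₁`, `c₆` and ratio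
`e = b₁ / (b₂ b₄) = b₆ / (b₃ b₅)`. -/
def cover1 (x : Fin 7 → ℝ) (e : ℝ) : DHParam :=
  ofRatios (x 0 * x 2 * e) (x 0) (x 1) (x 2) (x 3) (x 1 * x 3 * e)
    (x 5) (x 4 * x 3) (x 3 * x 6 * e) (x 0 * x 5 * e) (x 4 * x 0) (x 6)

theorem cover1_affine (j : ZMod 6 ⊕ ZMod 6 ⊕ ZMod 6) :
    ∃ A B : MvPolynomial (Fin 7) ℝ, ∀ x e, (cover1 x e).coords j = eval x A + eval x B * e := by
  rcases j with k | k | k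
  · revert k
    refine forall_zmod_six.2 ⟨⟨0, X 0 * X 2, fun x e => ?_⟩, ⟨X 0, 0, fun x e => ?_⟩,
      ⟨X 1, 0, fun x e => ?_⟩, ⟨X 2, 0, fun x e => ?_⟩, ⟨X 3, 0, fun x e => ?_⟩,
      ⟨0, X 1 * X 3, fun x e => ?_⟩⟩
    · change x 0 * x 2 * e = _
      simp
    · change x 0 = _
      simp
    · change x 1 = _
      simp
    · change x 2 = _
      simp
    · change x 3 = _
      simp
    · change x 1 * x 3 * e = _
      simp
  · revert k
    refine forall_zmod_six.2 ⟨⟨X 5, 0, fun x e => ?_⟩, ⟨X 4 * X 3, 0, fun x e => ?_⟩,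
      ⟨0, X 3 * X 6, fun x e => ?_⟩, ⟨0, X 0 * X 5, fun x e => ?_⟩, ⟨X 4 * X 0, 0, fun x e => ?_⟩,
      ⟨X 6, 0, fun x e => ?_⟩⟩
    · change x 5 = _
      simp
    · change x 4 * x 3 = _
      simp
    · change x 3 * x 6 * e = _
      simp
    · change x 0 * x 5 * e = _
      simp
    · change x 4 * x 0 = _
      simp
    · change x 6 = _
      simp
  · exact ⟨0, 0, fun x e => by simp [coords, cover1, ofRatios]⟩

theorem cover1_mem_component1 {x : Fin 7 → ℝ} {e : ℝ}
    (h : (x 0 ^ 2 * x 2 ^ 2 - x 1 ^ 2 * x 3 ^ 2) * e ^ 2 =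
      x 0 ^ 2 + x 2 ^ 2 - x 1 ^ 2 - x 3 ^ 2) : cover1 x e ∈ component1 := by
  refine ofRatios_mem_component1.2 ⟨⟨?_, ?_, ?_⟩, ?_, ?_, ?_, ?_, ?_⟩
  · ring
  · ring
  · ring
  · ring
  · ring
  · ring
  · ring
  · linear_combination h

theorem exists_cover1_eq {b₁ b₂ b₃ b₄ b₅ b₆ c₁ c₂ c₃ c₄ c₅ c₆ : ℝ}
    (h : ofRatios b₁ b₂ b₃ b₄ b₅ b₆ c₁ c₂ c₃ c₄ c₅ c₆ ∈ component1)
    (hr : (ofRatios b₁ b₂ b₃ b₄ b₅ b₆ c₁ c₂ c₃ c₄ c₅ c₆).Regular) (h25 : ¬ (b₂ = 0 ∧ b₅ = 0)) :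
    ∃ (x : Fin 7 → ℝ) (e : ℝ), x 0 ^ 2 * x 2 ^ 2 - x 1 ^ 2 * x 3 ^ 2 ≠ 0 ∧
      (x 0 ^ 2 * x 2 ^ 2 - x 1 ^ 2 * x 3 ^ 2) * e ^ 2 = x 0 ^ 2 + x 2 ^ 2 - x 1 ^ 2 - x 3 ^ 2 ∧
      ofRatios b₁ b₂ b₃ b₄ b₅ b₆ c₁ c₂ c₃ c₄ c₅ c₆ = cover1 x e := by
  obtain ⟨⟨R1, R2, R3⟩, f1, f2, f3, hP, hS⟩ := ofRatios_mem_component1.1 h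
  obtain ⟨-, n12, n23, n34, n45, n56, n61⟩ := ofRatios_regular.1 hr
  -- `b₂c₂ = b₅c₅` with `(b₂, b₅) ≠ 0` makes `(c₂, c₅)` a multiple of `(b₅, b₂)`.
  obtain ⟨κ, hκ2, hκ5⟩ : ∃ κ, c₂ = κ * b₅ ∧ c₅ = κ * b₂ := by
    by_cases h5 : b₅ = 0
    · have h2 : b₂ ≠ 0 := fun h2 => h25 ⟨h2, h5⟩
      refine ⟨c₅ / b₂, ?_, (div_mul_cancel₀ _ h2).symm⟩
      rw [h5, zero_mul] at f2
      rw [h5, mul_zero]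
      exact (mul_eq_zero.1 f2).resolve_left h2
    · refine ⟨c₂ / b₅, (div_mul_cancel₀ _ h5).symm, ?_⟩
      field_simp
      linear_combination -f2
  -- Regularity and `h25` keep `b₂b₄` and `b₃b₅` from vanishing together, so `e` can be read off
  -- from `b₁` or from `b₆`.
  obtain ⟨e, h1, h6, h3, h4⟩ : ∃ e, b₁ = b₂ * b₄ * e ∧ b₆ = b₃ * b₅ * e ∧ c₃ = b₅ * c₆ * e ∧
      c₄ = b₂ * c₁ * e := by
    by_cases hq : b₂ * b₄ = 0
    · have h3 : b₃ ≠ 0 := by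
        rintro rfl
        rcases mul_eq_zero.1 hq with rfl | rfl
        · exact n23 rfl
        · exact n34 rfl
      have h5 : b₅ ≠ 0 := by
        rintro rfl
        rcases mul_eq_zero.1 hq with rfl | rfl
        · exact h25 ⟨rfl, rfl⟩
        · exact n45 rfl
      refine ⟨b₆ / (b₃ * b₅), ?_, ?_, ?_, ?_⟩
      · field_simp
        linear_combination hP
      · field_simp
      · field_simp
        linear_combination f3
      · field_simp
        linear_combination R3
    · have h2 : b₂ ≠ 0 := left_ne_zero_of_mul hq
      have h4 : b₄ ≠ 0 := right_ne_zero_of_mul hq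
      refine ⟨b₁ / (b₂ * b₄), ?_, ?_, ?_, ?_⟩
      · field_simp
      · field_simp
        linear_combination -hP
      · field_simp
        linear_combination R2
      · field_simp
        linear_combination -f1
  have he : (b₂ ^ 2 * b₄ ^ 2 - b₃ ^ 2 * b₅ ^ 2) * e ^ 2 = b₂ ^ 2 + b₄ ^ 2 - b₃ ^ 2 - b₅ ^ 2 := by
    rw [h1, h6] at hS
    linear_combination hS
  refine ⟨![b₂, b₃, b₄, b₅, κ, c₁, c₆], e, ?_, he, ?_⟩
  · change b₂ ^ 2 * b₄ ^ 2 - b₃ ^ 2 * b₅ ^ 2 ≠ 0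
    -- If `N = 0`, then `G = 0` too. The pairs `b₂², b₄²` and `b₃², b₅²` then have equal sum and
    -- product, so they coincide, which makes adjacent squares equal.
    intro h0
    rw [h0, zero_mul] at he
    have hz : (b₂ ^ 2 - b₃ ^ 2) * (b₂ ^ 2 - b₅ ^ 2) = 0 := by
      linear_combination -b₂ ^ 2 * he - h0
    rcases mul_eq_zero.1 hz with hz | hz
    · exact n23 (sub_eq_zero.1 hz)
    · exact n34 (by linarith)
  · change _ = ofRatios (b₂ * b₄ * e) b₂ b₃ b₄ b₅ (b₃ * b₅ * e) c₁ (κ * b₅) (b₅ * c₆ * e)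
      (b₂ * c₁ * e) (κ * b₂) c₆
    rw [← h1, ← h6, ← hκ2, ← h3, ← h4, ← hκ5]

/-- A curve in the image of `cover1` that ends at a point with `b₂ = b₅ = 0`. -/
theorem eval_coords_eq_zero_of_cover1 {b₁ b₃ b₄ b₆ c₁ c₂ c₃ c₄ c₅ c₆ : ℝ}
    (h : ofRatios b₁ 0 b₃ b₄ 0 b₆ c₁ c₂ c₃ c₄ c₅ c₆ ∈ component1)
    (hr : (ofRatios b₁ 0 b₃ b₄ 0 b₆ c₁ c₂ c₃ c₄ c₅ c₆).Regular)
    {P : MvPolynomial (ZMod 6 ⊕ ZMod 6 ⊕ ZMod 6) ℝ}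
    (hP : ∀ (x : Fin 7 → ℝ) (e : ℝ), x 0 ^ 2 * x 2 ^ 2 - x 1 ^ 2 * x 3 ^ 2 ≠ 0 →
      (x 0 ^ 2 * x 2 ^ 2 - x 1 ^ 2 * x 3 ^ 2) * e ^ 2 = x 0 ^ 2 + x 2 ^ 2 - x 1 ^ 2 - x 3 ^ 2 →
      eval (cover1 x e).coords P = 0) :
    eval (ofRatios b₁ 0 b₃ b₄ 0 b₆ c₁ c₂ c₃ c₄ c₅ c₆).coords P = 0 := by
  obtain ⟨⟨R1, -, -⟩, f1, -, f3, -, hS⟩ := ofRatios_mem_component1.1 h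
  obtain ⟨-, n12, n23, n34, n45, n56, n61⟩ := ofRatios_regular.1 hr
  have h1 : b₁ ≠ 0 := by rintro rfl; exact n12 rfl
  have h3 : b₃ ≠ 0 := by rintro rfl; exact n23 rfl
  have h4 : b₄ ≠ 0 := by rintro rfl; exact n45 rfl
  have h6 : b₆ ≠ 0 := by rintro rfl; exact n56 rfl
  -- The cover misses this point, since `b₁ = b₂b₄e` would vanish; `e` has to tend to infinity. Put
  -- `b₂ = tβb₃`, `b₅ = tb₄b₆`, `e = 1/(tb₃b₄)`. The sum-of-squares equation then determines `β² =
  -- b₁²ρ`, with `β = b₁` at `t = 0`.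
  set ρ : ℝ → ℝ := fun t =>
    (b₄ ^ 2 + b₆ ^ 2 - b₃ ^ 2 - t ^ 2 * b₄ ^ 2 * b₆ ^ 2) / ((1 - t ^ 2 * b₃ ^ 2) * b₁ ^ 2) with hρ
  have hden : ContinuousAt (fun t : ℝ => 1 - t ^ 2 * b₃ ^ 2) 0 := by fun_prop
  have hρc : ContinuousAt ρ 0 := by
    refine ContinuousAt.div (by fun_prop) (by fun_prop) ?_
    simpa using h1
  have hρ0 : ρ 0 = 1 := by
    simp only [hρ]
    rw [div_eq_one_iff_eq (by simpa using h1)]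
    linear_combination -hS
  set β : ℝ → ℝ := fun t => b₁ * Real.sqrt (ρ t) with hβ
  have hβc : ContinuousAt β 0 := continuousAt_const.mul hρc.sqrt
  have hβ0 : β 0 = b₁ := by simp [hβ, hρ0]
  have hβsq : ∀ᶠ t in 𝓝 (0 : ℝ), β t ^ 2 * (1 - t ^ 2 * b₃ ^ 2) =
      b₄ ^ 2 + b₆ ^ 2 - b₃ ^ 2 - t ^ 2 * b₄ ^ 2 * b₆ ^ 2 := by
    filter_upwards [hρc.eventually (lt_mem_nhds (by rw [hρ0]; exact one_pos)),
      hden.eventually (lt_mem_nhds (by norm_num : (0 : ℝ) < _))] with t ht hd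
    have hsq : β t ^ 2 = b₁ ^ 2 * ρ t := by
      change (b₁ * Real.sqrt (ρ t)) ^ 2 = _
      rw [mul_pow, Real.sq_sqrt ht.le]
    have hd' := hd.ne'
    rw [hsq]
    simp only [hρ]
    generalize 1 - t ^ 2 * b₃ ^ 2 = d at hd' ⊢
    field_simp
  have hβ6 : ∀ᶠ t in 𝓝 (0 : ℝ), β t ^ 2 ≠ b₆ ^ 2 :=
    (hβc.pow 2).eventually_ne (by change β 0 ^ 2 ≠ _; rw [hβ0]; exact n61.symm)
  have lim : ∀ {g : ℝ → ℝ} {a : ℝ}, ContinuousAt g 0 → g 0 = a →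
      Tendsto g (𝓝[≠] 0) (𝓝 a) := fun hg ha => ha ▸ hg.tendsto.mono_left nhdsWithin_le_nhds
  refine eval_coords_eq_zero_of_tendsto (γ := fun t => ofRatios (β t) (t * β t * b₃) b₃ b₄
    (t * b₄ * b₆) b₆ c₁ c₂ (b₆ * c₆ / b₃) (β t * c₁ / b₄) (c₂ * β t * b₃ / (b₄ * b₆)) c₆)
    ?_ ?_ ?_ ?_
  · refine forall_zmod_six.2 ⟨lim hβc hβ0, lim (g := fun t => t * β t * b₃) ?_ ?_,
      tendsto_const_nhds, tendsto_const_nhds, lim (g := fun t => t * b₄ * b₆) ?_ ?_,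
      tendsto_const_nhds⟩
    · exact (continuousAt_id.mul hβc).mul continuousAt_const
    · change 0 * β 0 * b₃ = 0
      ring
    · fun_prop
    · change 0 * b₄ * b₆ = 0
      ring
  · refine forall_zmod_six.2 ⟨tendsto_const_nhds, tendsto_const_nhds,
      lim (g := fun _ => b₆ * c₆ / b₃) continuousAt_const ?_,
      lim (g := fun t => β t * c₁ / b₄) ((hβc.mul continuousAt_const).div_const _) ?_,
      lim (g := fun t => c₂ * β t * b₃ / (b₄ * b₆))
        (((continuousAt_const.mul hβc).mul continuousAt_const).div_const _) ?_,
      tendsto_const_nhds⟩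
    · change _ = c₃
      field_simp
      linear_combination -f3
    · change β 0 * c₁ / b₄ = c₄
      rw [hβ0]
      field_simp
      linear_combination f1
    · change c₂ * β 0 * b₃ / (b₄ * b₆) = c₅
      rw [hβ0]
      field_simp
      linear_combination R1
  · exact fun k => tendsto_const_nhds
  · filter_upwards [hβsq.filter_mono nhdsWithin_le_nhds, hβ6.filter_mono nhdsWithin_le_nhds,
      self_mem_nhdsWithin] with t hsq hne ht
    replace ht : t ≠ 0 := ht
    have hx := hP ![t * β t * b₃, b₃, b₄, t * b₄ * b₆, c₂ / (t * b₄ * b₆), c₁, c₆]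
      (1 / (t * b₃ * b₄))
    change ((t * β t * b₃) ^ 2 * b₄ ^ 2 - b₃ ^ 2 * (t * b₄ * b₆) ^ 2 ≠ 0 →
      ((t * β t * b₃) ^ 2 * b₄ ^ 2 - b₃ ^ 2 * (t * b₄ * b₆) ^ 2) * (1 / (t * b₃ * b₄)) ^ 2 =
        (t * β t * b₃) ^ 2 + b₄ ^ 2 - b₃ ^ 2 - (t * b₄ * b₆) ^ 2 →
      eval (ofRatios (t * β t * b₃ * b₄ * (1 / (t * b₃ * b₄))) (t * β t * b₃) b₃ b₄ (t * b₄ * b₆)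
        (b₃ * (t * b₄ * b₆) * (1 / (t * b₃ * b₄))) c₁ (c₂ / (t * b₄ * b₆) * (t * b₄ * b₆))
        (t * b₄ * b₆ * c₆ * (1 / (t * b₃ * b₄))) (t * β t * b₃ * c₁ * (1 / (t * b₃ * b₄)))
        (c₂ / (t * b₄ * b₆) * (t * β t * b₃)) c₆).coords P = 0) at hx
    -- Nonzero for small `t ≠ 0`, because `β² → b₁² ≠ b₆²`.
    have hN : (t * β t * b₃) ^ 2 * b₄ ^ 2 - b₃ ^ 2 * (t * b₄ * b₆) ^ 2 =
      (t * b₃ * b₄) ^ 2 * (β t ^ 2 - b₆ ^ 2) := by ring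
    have e1 : t * β t * b₃ * b₄ * (1 / (t * b₃ * b₄)) = β t := by field_simp
    have e6 : b₃ * (t * b₄ * b₆) * (1 / (t * b₃ * b₄)) = b₆ := by field_simp
    have g2 : c₂ / (t * b₄ * b₆) * (t * b₄ * b₆) = c₂ := by field_simp
    have g3 : t * b₄ * b₆ * c₆ * (1 / (t * b₃ * b₄)) = b₆ * c₆ / b₃ := by field_simp
    have g4 : t * β t * b₃ * c₁ * (1 / (t * b₃ * b₄)) = β t * c₁ / b₄ := by field_simp
    have g5 : c₂ / (t * b₄ * b₆) * (t * β t * b₃) = c₂ * β t * b₃ / (b₄ * b₆) := by field_simp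
    rw [e1, e6, g2, g3, g4, g5, hN] at hx
    refine hx (mul_ne_zero (by positivity) (sub_ne_zero.2 hne)) ?_
    field_simp
    linear_combination hsq

theorem isIrreducible_component1 : IsIrreducible (solutionSet ∩ component1) := by
  rw [solutionSet_inter_component1]
  have heval : ∀ x : Fin 7 → ℝ,
      eval x (X 0 ^ 2 * X 2 ^ 2 - X 1 ^ 2 * X 3 ^ 2 : MvPolynomial (Fin 7) ℝ) =
        x 0 ^ 2 * x 2 ^ 2 - x 1 ^ 2 * x 3 ^ 2 ∧
      eval x (X 0 ^ 2 + X 2 ^ 2 - X 1 ^ 2 - X 3 ^ 2 : MvPolynomial (Fin 7) ℝ) =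
        x 0 ^ 2 + x 2 ^ 2 - x 1 ^ 2 - x 3 ^ 2 := fun x => by simp
  refine isIrreducible_of_double_cover (Φ := cover1) (N := X 0 ^ 2 * X 2 ^ 2 - X 1 ^ 2 * X 3 ^ 2)
    (G := X 0 ^ 2 + X 2 ^ 2 - X 1 ^ 2 - X 3 ^ 2) cover1_affine ?_ ?_ ?_ ?_
  · refine ⟨ofRatios 1 2 3 1 2 3 0 0 0 0 0 0, ofRatios_mem_component1.2 ?_, ofRatios_regular.2 ?_⟩
    · norm_num
    · norm_num
  -- Here `N = 35`, `G = 11` and all `c` vanish, so regularity depends on `e² = 11/35` only and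
  -- holds on both sheets.
  · refine ⟨![2, 1, 3, 1, 0, 0, 0], (eventually_regular_double_cover cover1_affine ?_ ?_).mono
      fun x hx => ⟨hx.1, fun e he => ⟨?_, hx.2 e he⟩⟩⟩
    · rw [(heval _).1, (heval _).2]
      change (0 : ℝ) < (2 ^ 2 * 3 ^ 2 - 1 ^ 2 * 1 ^ 2) * (2 ^ 2 + 3 ^ 2 - 1 ^ 2 - 1 ^ 2)
      norm_num
    · intro e he
      rw [(heval _).1, (heval _).2] at he
      change ((2 : ℝ) ^ 2 * 3 ^ 2 - 1 ^ 2 * 1 ^ 2) * e ^ 2 = 2 ^ 2 + 3 ^ 2 - 1 ^ 2 - 1 ^ 2 at he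
      have he' : e ^ 2 = 11 / 35 := by linarith
      change (ofRatios (2 * 3 * e) 2 1 3 1 (1 * 1 * e) 0 (0 * 1) (1 * 0 * e) (2 * 0 * e) (0 * 2)
        0).Regular
      refine ofRatios_regular.2 ?_
      simp only [mul_pow, he']
      norm_num
    · rw [(heval _).1, (heval _).2] at he
      exact cover1_mem_component1 he
  -- `N = 7` and `G = -2`.
  · refine ⟨![2, 3, 2, 1, 0, 0, 0], ?_⟩
    rw [(heval _).1, (heval _).2]
    change ((2 : ℝ) ^ 2 * 2 ^ 2 - 3 ^ 2 * 1 ^ 2) * (2 ^ 2 + 2 ^ 2 - 3 ^ 2 - 1 ^ 2) < 0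
    norm_num
  · rintro P hP p ⟨hp, hr⟩
    have hP' : ∀ (x : Fin 7 → ℝ) (e : ℝ), x 0 ^ 2 * x 2 ^ 2 - x 1 ^ 2 * x 3 ^ 2 ≠ 0 →
        (x 0 ^ 2 * x 2 ^ 2 - x 1 ^ 2 * x 3 ^ 2) * e ^ 2 = x 0 ^ 2 + x 2 ^ 2 - x 1 ^ 2 - x 3 ^ 2 →
        eval (cover1 x e).coords P = 0 := fun x e => by
      rw [← (heval x).1, ← (heval x).2]
      exact hP x e
    obtain ⟨b₁, b₂, b₃, b₄, b₅, b₆, c₁, c₂, c₃, c₄, c₅, c₆, rfl⟩ := exists_ofRatios hp.1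
    by_cases h25 : b₂ = 0 ∧ b₅ = 0
    · obtain ⟨rfl, rfl⟩ := h25
      exact eval_coords_eq_zero_of_cover1 hp hr hP'
    · obtain ⟨x, e, hN, he, hxe⟩ := exists_cover1_eq hp hr h25
      rw [hxe]
      exact hP' x e hN he

end DHParam

/-! ### The second component -/

namespace DHParam

open MvPolynomial Topology Filter

/-- The points of the second component with given Bennett ratios and
`e = b₂`, `cₖ = x₅ bₖ₊₂ bₖ₊₄`. -/
def cover2 (x : Fin 6 → ℝ) (e : ℝ) : DHParam :=
  ofRatios (x 0) e (x 1) (x 2) (x 3) (x 4)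
    (x 5 * x 1 * x 3) (x 5 * x 2 * x 4) (x 5 * x 3 * x 0) (x 5 * x 4 * e) (x 5 * x 0 * x 1)
    (x 5 * x 2 * e)

theorem cover2_affine (j : ZMod 6 ⊕ ZMod 6 ⊕ ZMod 6) :
    ∃ A B : MvPolynomial (Fin 6) ℝ, ∀ x e, (cover2 x e).coords j = eval x A + eval x B * e := by
  rcases j with k | k | k
  · revert k
    refine forall_zmod_six.2 ⟨⟨X 0, 0, fun x e => ?_⟩, ⟨0, 1, fun x e => ?_⟩,
      ⟨X 1, 0, fun x e => ?_⟩, ⟨X 2, 0, fun x e => ?_⟩, ⟨X 3, 0, fun x e => ?_⟩,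
      ⟨X 4, 0, fun x e => ?_⟩⟩
    · change x 0 = _
      simp
    · change e = _
      simp
    · change x 1 = _
      simp
    · change x 2 = _
      simp
    · change x 3 = _
      simp
    · change x 4 = _
      simp
  · revert k
    refine forall_zmod_six.2 ⟨⟨X 5 * X 1 * X 3, 0, fun x e => ?_⟩,
      ⟨X 5 * X 2 * X 4, 0, fun x e => ?_⟩, ⟨X 5 * X 3 * X 0, 0, fun x e => ?_⟩,
      ⟨0, X 5 * X 4, fun x e => ?_⟩, ⟨X 5 * X 0 * X 1, 0, fun x e => ?_⟩,
      ⟨0, X 5 * X 2, fun x e => ?_⟩⟩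
    · change x 5 * x 1 * x 3 = _
      simp
    · change x 5 * x 2 * x 4 = _
      simp
    · change x 5 * x 3 * x 0 = _
      simp
    · change x 5 * x 4 * e = _
      simp
    · change x 5 * x 0 * x 1 = _
      simp
    · change x 5 * x 2 * e = _
      simp
  · exact ⟨0, 0, fun x e => by simp [coords, cover2, ofRatios]⟩

theorem cover2_mem_component2 {x : Fin 6 → ℝ} {e : ℝ}
    (h : (1 - x 5 ^ 2 * x 2 ^ 2 * x 4 ^ 2) * e ^ 2 =
      (1 - x 5 ^ 2 * x 1 ^ 2 * x 3 ^ 2) * x 0 ^ 2 + x 1 ^ 2 + x 3 ^ 2 - x 2 ^ 2 - x 4 ^ 2) :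
    cover2 x e ∈ component2 := by
  refine ofRatios_mem_component2.2 ⟨⟨?_, ?_, ?_⟩, ?_, ?_, ?_, ?_, ?_, ?_⟩
  · ring
  · ring
  · ring
  · ring
  · ring
  · ring
  · ring
  · ring
  · linear_combination -h

/-- On the regular part of the second component, `cₖ` is proportional to `bₖ₊₂ bₖ₊₄`. -/
theorem exists_c_eq_mul {b₁ b₂ b₃ b₄ b₅ b₆ c₁ c₂ c₃ c₄ c₅ c₆ : ℝ}
    (h : ofRatios b₁ b₂ b₃ b₄ b₅ b₆ c₁ c₂ c₃ c₄ c₅ c₆ ∈ component2)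
    (hr : (ofRatios b₁ b₂ b₃ b₄ b₅ b₆ c₁ c₂ c₃ c₄ c₅ c₆).Regular) :
    ∃ r, c₁ = r * b₃ * b₅ ∧ c₂ = r * b₄ * b₆ ∧ c₃ = r * b₅ * b₁ ∧ c₄ = r * b₆ * b₂ ∧
      c₅ = r * b₁ * b₃ ∧ c₆ = r * b₂ * b₄ := by
  obtain ⟨⟨R1, R2, R3⟩, f13, f35, f24, f46, -, -⟩ := ofRatios_mem_component2.1 h
  obtain ⟨-, n12, n23, n34, n45, n56, n61⟩ := ofRatios_regular.1 hr
  have nz : ∀ {a b : ℝ}, a = 0 → a ^ 2 ≠ b ^ 2 → b ≠ 0 := by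
    rintro a b rfl h rfl
    exact h rfl
  -- a point with two opposite vanishing Bennett ratios
  have opposite : ∀ {a₁ a₂ a₃ a₄ a₅ a₆ d₁ d₂ d₃ d₄ d₅ d₆ : ℝ}, a₁ = 0 → a₄ = 0 → a₂ ≠ 0 → a₃ ≠ 0 →
      a₅ ≠ 0 → a₆ ≠ 0 → a₁ * d₁ = a₃ * d₃ → a₃ * d₃ = a₅ * d₅ → a₂ * d₂ = a₄ * d₄ →
      a₄ * d₄ = a₆ * d₆ → a₃ * d₄ * a₅ = a₆ * d₁ * a₂ →
      ∃ r, d₁ = r * a₃ * a₅ ∧ d₂ = r * a₄ * a₆ ∧ d₃ = r * a₅ * a₁ ∧ d₄ = r * a₆ * a₂ ∧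
        d₅ = r * a₁ * a₃ ∧ d₆ = r * a₂ * a₄ := by
    intro a₁ a₂ a₃ a₄ a₅ a₆ d₁ d₂ d₃ d₄ d₅ d₆ h1 h4 h2 h3 h5 h6 e13 e35 e24 e46 e
    subst h1 h4
    have z3 : d₃ = 0 := by simpa [h3] using e13.symm
    have z5 : d₅ = 0 := by simpa [h5, z3] using e35.symm
    have z2 : d₂ = 0 := by simpa [h2] using e24
    have z6 : d₆ = 0 := by simpa [h6] using e46.symm
    refine ⟨d₁ / (a₃ * a₅), ?_, ?_, ?_, ?_, ?_, ?_⟩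
    · field_simp
    · simp [z2]
    · simp [z3]
    · field_simp
      linear_combination e
    · simp [z5]
    · simp [z6]
  by_cases hodd : b₁ ≠ 0 ∧ b₃ ≠ 0 ∧ b₅ ≠ 0
  · obtain ⟨h1, h3, h5⟩ := hodd
    refine ⟨c₁ / (b₃ * b₅), ?_, ?_, ?_, ?_, ?_, ?_⟩
    · field_simp
    · rw [div_mul_eq_mul_div, div_mul_eq_mul_div, eq_div_iff (mul_ne_zero h3 h5)]
      refine mul_left_cancel₀ h1 ?_
      linear_combination b₅ * R1 - b₄ * b₆ * (f13 + f35)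
    · field_simp
      linear_combination -f13
    · field_simp
      linear_combination R3
    · field_simp
      linear_combination -f13 - f35
    · rw [div_mul_eq_mul_div, div_mul_eq_mul_div, eq_div_iff (mul_ne_zero h3 h5)]
      refine mul_left_cancel₀ h1 ?_
      linear_combination -b₃ * R2 - b₂ * b₄ * f13
  by_cases heven : b₂ ≠ 0 ∧ b₄ ≠ 0 ∧ b₆ ≠ 0
  · obtain ⟨h2, h4, h6⟩ := heven
    refine ⟨c₂ / (b₄ * b₆), ?_, ?_, ?_, ?_, ?_, ?_⟩
    · rw [div_mul_eq_mul_div, div_mul_eq_mul_div, eq_div_iff (mul_ne_zero h4 h6)]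
      refine mul_left_cancel₀ h2 ?_
      linear_combination -b₄ * R3 - b₃ * b₅ * f24
    · field_simp
    · rw [div_mul_eq_mul_div, div_mul_eq_mul_div, eq_div_iff (mul_ne_zero h4 h6)]
      refine mul_left_cancel₀ h2 ?_
      linear_combination b₆ * R2 - b₅ * b₁ * (f24 + f46)
    · field_simp
      linear_combination -f24
    · field_simp
      linear_combination -R1
    · field_simp
      linear_combination -f24 - f46
  -- Now some odd-indexed and some even-indexed ratio vanish. Adjacent ratios are never both zero,
  -- so the two are opposite; the three cases are rotations of `opposite`.
  by_cases h1 : b₁ = 0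
  · have h2 := nz h1 n12
    have h6 := nz h1 n61.symm
    have h4 : b₄ = 0 := by tauto
    exact opposite h1 h4 h2 (nz h4 n34.symm) (nz h4 n45) h6 f13 f35 f24 f46 R3
  by_cases h3 : b₃ = 0
  · have h4 := nz h3 n34
    have h2 := nz h3 n23.symm
    have h6 : b₆ = 0 := by tauto
    obtain ⟨r, g3, g4, g5, g6, g1, g2⟩ := opposite h3 h6 h4 (nz h6 n56.symm) (nz h6 n61) h2 f35
      (f13.trans f35).symm f46 (f24.trans f46).symm (by linear_combination -R2)
    exact ⟨r, g1, g2, g3, g4, g5, g6⟩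
  · have h5 : b₅ = 0 := by tauto
    have h6 := nz h5 n56
    have h4 := nz h5 n45.symm
    have h2 : b₂ = 0 := by tauto
    obtain ⟨r, g5, g6, g1, g2, g3, g4⟩ := opposite h5 h2 h6 h1 h3 h4 (f13.trans f35).symm f13
      (f24.trans f46).symm f24 (by linear_combination R1)
    exact ⟨r, g1, g2, g3, g4, g5, g6⟩

theorem exists_cover2_eq {b₁ b₂ b₃ b₄ b₅ b₆ c₁ c₂ c₃ c₄ c₅ c₆ : ℝ}
    (h : ofRatios b₁ b₂ b₃ b₄ b₅ b₆ c₁ c₂ c₃ c₄ c₅ c₆ ∈ component2)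
    (hr : (ofRatios b₁ b₂ b₃ b₄ b₅ b₆ c₁ c₂ c₃ c₄ c₅ c₆).Regular) :
    ∃ (x : Fin 6 → ℝ) (e : ℝ), 1 - x 5 ^ 2 * x 2 ^ 2 * x 4 ^ 2 ≠ 0 ∧
      (1 - x 5 ^ 2 * x 2 ^ 2 * x 4 ^ 2) * e ^ 2 =
        (1 - x 5 ^ 2 * x 1 ^ 2 * x 3 ^ 2) * x 0 ^ 2 + x 1 ^ 2 + x 3 ^ 2 - x 2 ^ 2 - x 4 ^ 2 ∧
      ofRatios b₁ b₂ b₃ b₄ b₅ b₆ c₁ c₂ c₃ c₄ c₅ c₆ = cover2 x e := by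
  obtain ⟨r, h1, h2, h3, h4, h5, h6⟩ := exists_c_eq_mul h hr
  obtain ⟨-, -, -, -, -, -, hS⟩ := ofRatios_mem_component2.1 h
  obtain ⟨⟨-, hc2, -⟩, -⟩ := ofRatios_regular.1 hr
  refine ⟨![b₁, b₃, b₄, b₅, b₆, r], b₂, ?_, ?_, ?_⟩
  · change 1 - r ^ 2 * b₄ ^ 2 * b₆ ^ 2 ≠ 0
    -- `N = 1 - c₂²` is positive because `|c₂| < 1`, so no limit argument is needed here.
    rw [show r ^ 2 * b₄ ^ 2 * b₆ ^ 2 = c₂ ^ 2 by rw [h2]; ring]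
    exact (sub_pos.2 (sq_lt_one_iff_abs_lt_one _ |>.2 (abs_lt.2 hc2))).ne'
  · change (1 - r ^ 2 * b₄ ^ 2 * b₆ ^ 2) * b₂ ^ 2 =
      (1 - r ^ 2 * b₃ ^ 2 * b₅ ^ 2) * b₁ ^ 2 + b₃ ^ 2 + b₅ ^ 2 - b₄ ^ 2 - b₆ ^ 2
    rw [h1, h2] at hS
    linear_combination -hS
  · change _ = ofRatios b₁ b₂ b₃ b₄ b₅ b₆ (r * b₃ * b₅) (r * b₄ * b₆) (r * b₅ * b₁) (r * b₆ * b₂)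
      (r * b₁ * b₃) (r * b₄ * b₂)
    rw [h1, h2, h3, h4, h5, h6, mul_right_comm r b₂ b₄]

theorem isIrreducible_component2 : IsIrreducible (solutionSet ∩ component2) := by
  rw [solutionSet_inter_component2]
  have heval : ∀ x : Fin 6 → ℝ,
      eval x (1 - X 5 ^ 2 * X 2 ^ 2 * X 4 ^ 2 : MvPolynomial (Fin 6) ℝ) =
        1 - x 5 ^ 2 * x 2 ^ 2 * x 4 ^ 2 ∧
      eval x ((1 - X 5 ^ 2 * X 1 ^ 2 * X 3 ^ 2) * X 0 ^ 2 + X 1 ^ 2 + X 3 ^ 2 - X 2 ^ 2 - X 4 ^ 2 :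
          MvPolynomial (Fin 6) ℝ) =
        (1 - x 5 ^ 2 * x 1 ^ 2 * x 3 ^ 2) * x 0 ^ 2 + x 1 ^ 2 + x 3 ^ 2 - x 2 ^ 2 - x 4 ^ 2 :=
    fun x => by simp
  refine isIrreducible_of_double_cover (Φ := cover2) (N := 1 - X 5 ^ 2 * X 2 ^ 2 * X 4 ^ 2)
    (G := (1 - X 5 ^ 2 * X 1 ^ 2 * X 3 ^ 2) * X 0 ^ 2 + X 1 ^ 2 + X 3 ^ 2 - X 2 ^ 2 - X 4 ^ 2)
    cover2_affine ?_ ?_ ?_ ?_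
  · refine ⟨ofRatios 1 2 3 1 2 3 0 0 0 0 0 0, ofRatios_mem_component2.2 ?_, ofRatios_regular.2 ?_⟩
    · norm_num
    · norm_num
  -- The Bennett ratios are `3, ±5, 3, 1, 3, 1`, with all `c` zero.
  · refine ⟨![3, 3, 1, 3, 1, 0], (eventually_regular_double_cover cover2_affine ?_ ?_).mono
      fun x hx => ⟨hx.1, fun e he => ⟨?_, hx.2 e he⟩⟩⟩
    · rw [(heval _).1, (heval _).2]
      change (0 : ℝ) < (1 - 0 ^ 2 * 1 ^ 2 * 1 ^ 2) *
        ((1 - 0 ^ 2 * 3 ^ 2 * 3 ^ 2) * 3 ^ 2 + 3 ^ 2 + 3 ^ 2 - 1 ^ 2 - 1 ^ 2)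
      norm_num
    · intro e he
      rw [(heval _).1, (heval _).2] at he
      change (1 - (0 : ℝ) ^ 2 * 1 ^ 2 * 1 ^ 2) * e ^ 2 =
        (1 - 0 ^ 2 * 3 ^ 2 * 3 ^ 2) * 3 ^ 2 + 3 ^ 2 + 3 ^ 2 - 1 ^ 2 - 1 ^ 2 at he
      have he' : e ^ 2 = 25 := by linarith
      change (ofRatios 3 e 3 1 3 1 (0 * 3 * 3) (0 * 1 * 1) (0 * 3 * 3) (0 * 1 * e) (0 * 3 * 3)
        (0 * 1 * e)).Regular
      refine ofRatios_regular.2 ?_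
      rw [he']
      norm_num
    · rw [(heval _).1, (heval _).2] at he
      exact cover2_mem_component2 he
  · refine ⟨![0, 0, 1, 0, 0, 0], ?_⟩
    rw [(heval _).1, (heval _).2]
    change (1 - (0 : ℝ) ^ 2 * 1 ^ 2 * 0 ^ 2) *
        ((1 - 0 ^ 2 * 0 ^ 2 * 0 ^ 2) * 0 ^ 2 + 0 ^ 2 + 0 ^ 2 - 1 ^ 2 - 0 ^ 2) < 0
    norm_num
  · rintro P hP p ⟨hp, hr⟩
    obtain ⟨b₁, b₂, b₃, b₄, b₅, b₆, c₁, c₂, c₃, c₄, c₅, c₆, rfl⟩ := exists_ofRatios hp.1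
    obtain ⟨x, e, hN, he, hxe⟩ := exists_cover2_eq hp hr
    rw [hxe]
    refine hP x e ?_ ?_
    · rwa [(heval x).1]
    · rwa [(heval x).1, (heval x).2]

/-! ### Assembling the two components -/

theorem irreducibleComponents_solutionSet :
    irreducibleComponents solutionSet =
      {Subtype.val ⁻¹' component1, Subtype.val ⁻¹' component2} ∧
    (Subtype.val ⁻¹' component1 : Set solutionSet) ≠ Subtype.val ⁻¹' component2 := by
  have h₁₂ : ¬ (Subtype.val ⁻¹' component1 : Set solutionSet) ⊆ Subtype.val ⁻¹' component2 := by
    intro h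
    -- `f₁ = 1/2` and `f₃ = 0` keep this point out of the second component.
    have h₁ : ofRatios 1 2 3 1 2 3 (1 / 2) 0 0 (1 / 2) 0 0 ∈ component1 :=
      ofRatios_mem_component1.2 (by norm_num)
    have hmem : ofRatios 1 2 3 1 2 3 (1 / 2) 0 0 (1 / 2) 0 0 ∈ solutionSet ∩ component1 := by
      rw [solutionSet_inter_component1]
      exact ⟨h₁, ofRatios_regular.2 (by norm_num)⟩
    have h₂ := ofRatios_mem_component2.1 (h (a := ⟨_, hmem.1⟩) h₁)
    norm_num at h₂
  have h₂₁ : ¬ (Subtype.val ⁻¹' component2 : Set solutionSet) ⊆ Subtype.val ⁻¹' component1 := by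
    intro h
    -- `b₁b₃b₅ = 27` and `b₂b₄b₆ = 5` keep this point out of the first component.
    have h₂ : ofRatios 3 5 3 1 3 1 0 0 0 0 0 0 ∈ component2 :=
      ofRatios_mem_component2.2 (by norm_num)
    have hmem : ofRatios 3 5 3 1 3 1 0 0 0 0 0 0 ∈ solutionSet ∩ component2 := by
      rw [solutionSet_inter_component2]
      exact ⟨h₂, ofRatios_regular.2 (by norm_num)⟩
    have h₁ := ofRatios_mem_component1.1 (h (a := ⟨_, hmem.1⟩) h₂)
    norm_num at h₁
  refine ⟨irreducibleComponents_eq_pair (isIrreducible_preimage_val isIrreducible_component1)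
    (isIrreducible_preimage_val isIrreducible_component2)
    (isClosed_component1.preimage continuous_subtype_val)
    (isClosed_component2.preimage continuous_subtype_val) ?_ h₁₂ h₂₁, fun h => h₁₂ h.subset⟩
  refine Set.eq_univ_of_forall fun p => ?_
  have : p.1 ∈ component1 ∪ component2 := setOf_equations24 ▸ p.2.2
  exact this

end DHParam

theorem mainTheorem6 :
    -- the six polynomial equalities amount to the 24 real equations
    (∀ p : DHParam, p.QuadEqualities ↔ p.Equations24) ∧
    -- the zero set, even without the standing assumptions, is the union of the two explicit sets
    {p : DHParam | p.Equations24} = DHParam.component1 ∪ DHParam.component2 ∧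
    -- under the standing assumptions these are precisely the irreducible components, and distinct
    irreducibleComponents DHParam.solutionSet =
      {Subtype.val ⁻¹' DHParam.component1, Subtype.val ⁻¹' DHParam.component2} ∧
    (Subtype.val ⁻¹' DHParam.component1 : Set DHParam.solutionSet) ≠
      Subtype.val ⁻¹' DHParam.component2 ∧
    -- the three common equations are redundant if no Bennett ratio is zero
    (∀ p : DHParam, (∀ k, p.b k ≠ 0) → p.Family1 ∨ p.Family2 → p.Red) :=
  ⟨DHParam.quadEqualities_iff_equations24, DHParam.setOf_equations24,
    DHParam.irreducibleComponents_solutionSet.1, DHParam.irreducibleComponents_solutionSet.2,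
    DHParam.red_of_family⟩
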